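/- Conventions. Put $\ell_0=x$, $\ell_1=\ell=\frac{1}{-\log x}$ and $\ell_{k+1}=\frac{1}{-\log \ell_k}$. Order the monomials $x^{\gamma_0}\ell_1^{\gamma_1}\cdots\ell_j^{\gamma_j}$ lexicographically by their exponents $(\gamma_0,\dots,\gamma_j)\in\mathbb R^{j+1}$. For $j\ge 0$ let $\widehat{\mathcal L}_j^\infty$ be the set of formal sums $$\sum_{i_0}\sum_{i_1}\cdots\sum_{i_j} a_{i_0\ldots i_j}\,x^{\alpha_{i_0}}\ell_1^{\alpha_{i_0i_1}}\cdots\ell_j^{\alpha_{i_0\ldots i_j}},\qquad a_{i_0\ldots i_j}\in\mathbb R,$$ in which, for every $k\le j$ and every $i_0,\dots,i_{k-1}$, the real sequence $(\alpha_{i_0\ldots i_k})_{i_k}$ is strictly increasing and either finite or tending to $+\infty$. Put $\widehat{\mathfrak L}=\bigcup_j\widehat{\mathcal L}_j^\infty$, and let $\widehat{\mathcal L}\subset\widehat{\mathcal L}_1^\infty$ be the set of those transseries in which all exponents of $x$ are strictly positive and all exponents of $\ell$ are integers. A transseries $\widehat f\in\widehat{\mathcal L}$ is called parabolic if $\widehat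 f=x+\text{(terms of higher order)}$. The composition $\widehat g\circ\widehat h=\widehat g(\widehat h)$ is the formal substitution of $\widehat h$ for $x$ in $\widehat g$. A formal Fatou coordinate of a parabolic $\widehat f$ is a $\widehat\Psi\in\widehat{\mathfrak L}$ with $\widehat\Psi(\widehat f)-\widehat\Psi=1$. A $C^1$ formal flow in $\widehat{\mathcal L}$ is a family $\{\widehat f^t\}_{t\in\mathbb R}\subset\widehat{\mathcal L}$ such that $\widehat f^0=x$ and $\widehat f^{t+s}=\widehat f^t\circ\widehat f^s$ for all $s,t\in\mathbb R$, the union $S$ of the supports of all $\widehat f^t$ is well-ordered, and for every exponent in $S$ the coefficient of $\widehat f^t$ at this exponent is a $C^1$ function of $t\in\mathbb R$. The transseries $\widehat f$ embeds in the flow as the time-one map if $\widehat f^1=\widehat f$. Proposition. Let $\widehat f\in\widehat{\mathcal L}$ be parabolic and $\widehat f\neq x$. Then: 1. A formal Fatou coordinate $\widehat\Psi\in\widehat{\mathfrak L}$ of $\widehat f$ exists, and it is unique up to an additive constant: if $\widehat\Psi$ is one, then the formal Fatou coordinates of $\widehat f$ are exactly the transseries $\widehat\Psi+c$, $c\in\mathbb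 R$. 2. Every formal Fatou coordinate of $\widehat f$ belongs to $\widehat{\mathcal L}_2^\infty$. 3. There is a unique $C^1$ formal flow $\{\widehat f^t\}_{t\in\mathbb R}$ in $\widehat{\mathcal L}$ in which $\widehat f$ embeds as the time-one map, and every formal Fatou coordinate $\widehat\Psi$ of $\widehat f$ satisfies $\widehat\Psi(\widehat f^t)-\widehat\Psi=t$ for all $t\in\mathbb R$. -/

import Mathlib

/-! Transseries in the iterated logarithms `ℓ₀ = x`, `ℓ₁ = 1 / (-log x)`,
`ℓ_{k+1} = 1 / (-log ℓ_k)`, with real coefficients and real exponents. -/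

namespace LogTransseries

/-- The exponent `γ` of the monomial `∏ k, ℓ_k ^ (γ k)` (finitely many factors).  Exponents are
ordered lexicographically; as `x → 0+`, a larger exponent means a smaller monomial. -/
abbrev Exponent : Type := Lex (ℕ →₀ ℝ)

/-- Formal sums of monomials with real coefficients and well-ordered support (a field): the
ambient space in which all the classes of transseries below live. -/
abbrev Transseries : Type := HahnSeries Exponent ℝ

/-- The exponent of the monomial `ℓ_k`. -/
noncomputable def unitExp (k : ℕ) : Exponent := toLex (Finsupp.single k 1)

/-- The identity transseries `x`. -/
noncomputable def X : Transseries := HahnSeries.single (unitExp 0) 1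

/-- The constant transseries `c`. -/
noncomputable def const (c : ℝ) : Transseries := HahnSeries.C c

/-! ### The classes of power-iterated logarithm transseries -/

/-- `f` is a sum `∑_{i₀} ∑_{i₁} … ∑_{i_j} a_{i₀…i_j} x^{α_{i₀}} ℓ₁^{α_{i₀ i₁}} ⋯ ℓ_j^{α_{i₀…i_j}}` in
which, for every `k ≤ j` and fixed `i₀, …, i_{k-1}`, the exponents `α_{i₀…i_k}` form a strictly
increasing real sequence (in `i_k`) which is finite or tends to `+∞`.  In terms of the support:
for every prefix `p 0, …, p (k-1)`, only finitely many values below any given bound occur as the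
`k`-th exponent of a monomial of `f` whose first `k` exponents are this prefix. -/
def LInf (j : ℕ) : Set Transseries :=
  {f | (∀ γ ∈ f.support, ∀ k, j < k → ofLex γ k = 0) ∧
    ∀ (k : ℕ) (p : ℕ → ℝ) (M : ℝ),
      {r : ℝ | r ≤ M ∧ ∃ γ ∈ f.support, (∀ i < k, ofLex γ i = p i) ∧ ofLex γ k = r}.Finite}

/-- All power-iterated logarithm transseries of finite depth. -/
def LAll : Set Transseries := ⋃ j : ℕ, LInf j

/-- The class of depth-one transseries with strictly positive powers of `x` and integer powers of
`ℓ₁`. -/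
def LHat : Set Transseries :=
  {f | f ∈ LInf 1 ∧ ∀ γ ∈ f.support, 0 < ofLex γ 0 ∧ ∃ m : ℤ, ofLex γ 1 = m}

/-- `f ∈ LHat` is parabolic if its leading term is `x`, i.e. `f = x + (higher order terms)`. -/
def IsParabolic (f : Transseries) : Prop :=
  f ∈ LHat ∧ f.order = unitExp 0 ∧ f.leadingCoeff = 1

/-! ### Formal composition

A nonzero `h` is written `h = a m (1 + ε)` with leading term `a m` and `ε` of positive order. -/

/-- The relative remainder `ε` in `h = a m (1 + ε)`. -/
noncomputable def remainder (h : Transseries) : Transseries :=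
  h * HahnSeries.single (-h.order) (h.leadingCoeff)⁻¹ - 1

/-- The real power `h ^ c = a ^ c * m ^ c * (1 + ε) ^ c` (for `a > 0`), where `(1 + ε) ^ c` is the
binomial series. -/
noncomputable def rpow (h : Transseries) (c : ℝ) : Transseries :=
  HahnSeries.single (c • h.order) (h.leadingCoeff ^ c) *
    PowerSeries.heval (remainder h) (PowerSeries.binomialSeries ℝ c)

/-- `-log h = -log m - log a - log (1 + ε)` (for `a > 0`), where `-log (∏ k, ℓ_k ^ (γ k))` is
`∑ k, γ k * ℓ_{k+1}⁻¹` and `log (1 + ε)` is the usual power series. -/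
noncomputable def negLog (h : Transseries) : Transseries :=
  (ofLex h.order).sum (fun k c => HahnSeries.single (-unitExp (k + 1)) c)
    - const (Real.log h.leadingCoeff)
    - PowerSeries.heval (remainder h) (PowerSeries.log ℝ)

/-- The substitution `ℓ_k ∘ h`: `ℓ₀ ∘ h = h` and `ℓ_{k+1} ∘ h = 1 / (-log (ℓ_k ∘ h))`. -/
noncomputable def ellComp (h : Transseries) : ℕ → Transseries
  | 0 => h
  | k + 1 => (negLog (ellComp h k))⁻¹

/-- The substitution of `h` into the monomial with exponent `γ`: `∏ k, (ℓ_k ∘ h) ^ (γ k)`. -/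
noncomputable def monoComp (γ : Exponent) (h : Transseries) : Transseries :=
  (ofLex γ).prod (fun k c => rpow (ellComp h k) c)

/-- `IsComp g h r` says that `g ∘ h` is defined and equal to `r`: the inner transseries `h` is
positive and infinitesimal, and the family of all `(coefficient of γ in g) • (monomial γ ∘ h)` is
summable (well-ordered union of supports, each monomial occurring in only finitely many members)
with sum `r`. -/
def IsComp (g h r : Transseries) : Prop :=
  0 < h.leadingCoeff ∧ 0 < h.order ∧
    ∃ s : HahnSeries.SummableFamily Exponent ℝ Exponent,
      (∀ γ, s γ = g.coeff γ • monoComp γ h) ∧ s.hsum = r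

/-! ### Fatou coordinates and flows -/

/-- `Ψ` is a formal Fatou coordinate for `f`: `Ψ` is a power-iterated logarithm transseries of
finite depth with `Ψ(f) - Ψ = 1`. -/
def IsFatou (f Ψ : Transseries) : Prop :=
  Ψ ∈ LAll ∧ ∃ r, IsComp Ψ f r ∧ r - Ψ = 1

/-- `F` is a `C¹` formal flow in `LHat`. -/
structure IsC1Flow (F : ℝ → Transseries) : Prop where
  mem : ∀ t, F t ∈ LHat
  zero : F 0 = X
  add : ∀ s t, IsComp (F t) (F s) (F (t + s))
  wellOrdered : (⋃ t, (F t).support).IsWF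
  contDiff : ∀ γ ∈ ⋃ t, (F t).support, ContDiff ℝ 1 (fun t => (F t).coeff γ)

/-- `f` embeds in the `C¹` formal flow `F` as the time-one map. -/
def EmbedsInC1Flow (f : Transseries) (F : ℝ → Transseries) : Prop :=
  IsC1Flow F ∧ F 1 = f

end LogTransseries

/-!
A parabolic `f ≠ x` is written `f = x (1 + z)` with `z` of positive order. Substitution of `f` into
a monomial `m_γ` multiplies it by a series supported in the well-ordered monoid generated by
`supp z` and the exponents of the `ℓ_k` (`mon`, `shiftBounded_mon`), so composition with `f` is a
strongly linear operator `lin (mon z)`, multiplicative and compatible with substitution into power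
series (`isComp_iff`, `lin_mon_mul`, `lin_mon_heval`). The identity
`log ((1 + a) (1 + b)) = log (1 + a) + log (1 + b)` for formal series makes composition associative
(`lin_mon_lin_mon`); on remainders `z` it becomes the operation `star`.

The difference `m_γ ∘ f - m_γ` has the leading exponent `γ + sig k + ord z`, where `k` is the first
index with `γ_k ≠ 0` and `sig k` is the exponent of `ℓ₁ ⋯ ℓ_k` (`coeff_mon`). Two facts follow.
First, `γ ↦ γ + sig k` is strictly increasing for `γ ≠ 0`, so only constants are invariant under
composition with `f` (`eq_const_of_isComp_self`), which is the uniqueness of the Fatou coordinate.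
Second, every exponent `β` with `β - ord z` of depth one is the leading exponent of the increment of
a monomial which is of depth one, or equal to `ℓ₂⁻¹` in a single case (`primExp_isLead`). Hence
`Ψ ∘ f - Ψ = 1` becomes a triangular system over a well-ordered set of exponents, whose solution has
depth at most two (`exists_lin_mon_eq_add_one`).

The coefficients of the `n`-th iterate of `f` are polynomials in `n` (`exists_polynomial_coeff`),
and replacing `n` by a real number `t` gives the flow. The flow law and `Ψ(f^t) - Ψ = t` are
identities between series with polynomial coefficients, so they hold because they hold for natural `t`
(`star_eval`, `lin_mon_eval_of_add_one`).

For the uniqueness of the flow, the leading exponents of the members `F t` of a flow obey a cocycle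
law and have a least element because the union of the supports is well-ordered, so that all of them
equal that of `x`; the leading coefficients form a continuous one-parameter group which is `1` at
time one (`IsC1Flow.eq_X_mul`). Each `F t` commutes with `f`, so it changes `Ψ` by a constant `c t` and
coincides with the polynomial flow at time `c t`; the function `c` is additive and continuous with
`c 1 = 1`, so it is the identity (`IsC1Flow.eq_polynomial_flow`).
-/

namespace LogTransseries

open HahnSeries

/-! ### Strongly linear operators on Hahn series -/

section Kernel

variable {Γ : Type*} [AddCommGroup Γ] [LinearOrder Γ] [IsOrderedAddMonoid Γ]
  {R : Type*} [CommRing R]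

theorem orderTop_pos_iff {x : HahnSeries Γ R} : 0 < x.orderTop ↔ ∀ γ ∈ x.support, 0 < γ := by
  by_cases hx : x = 0
  · simp [hx]
  rw [zero_lt_orderTop_iff hx]
  constructor
  · intro h γ hγ
    exact h.trans_le (order_le_of_coeff_ne_zero hγ)
  · intro h
    exact h _ (by simpa using hx)

theorem finite_sub_mem {A S : Set Γ} (hA : A.IsPWO) (hS : S.IsPWO) (β : Γ) :
    {γ | γ ∈ A ∧ β - γ ∈ S}.Finite := by
  refine ((Set.AddAntidiagonal.finite_of_isPWO hA hS β).image Prod.fst).subset ?_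
  rintro γ ⟨h1, h2⟩
  exact ⟨(γ, β - γ), ⟨h1, h2, by simp⟩, rfl⟩

/-- `m γ` is supported in `γ + S` for every `γ ∈ Λ`, where `S` is well-ordered. This uniform bound
makes all the families `γ ↦ g_γ • m γ` with `g` supported in `Λ` summable. -/
def ShiftBounded (S Λ : Set Γ) (m : Γ → HahnSeries Γ R) : Prop :=
  S.IsPWO ∧ ∀ γ ∈ Λ, ∀ β ∈ (m γ).support, β - γ ∈ S

open Classical in
/-- The strongly linear operator with `single γ 1 ↦ m γ`, that is `g ↦ ∑ γ, g_γ • m γ`; the junk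
value is `0` if this family is not summable. -/
noncomputable def lin (m : Γ → HahnSeries Γ R) (g : HahnSeries Γ R) : HahnSeries Γ R :=
  if h : (⋃ γ, (g.coeff γ • m γ).support).IsPWO ∧
      ∀ β, {γ | (g.coeff γ • m γ).coeff β ≠ 0}.Finite then
    (SummableFamily.mk (fun γ => g.coeff γ • m γ) h.1 h.2).hsum
  else 0

variable {S Λ : Set Γ} {m : Γ → HahnSeries Γ R} {g : HahnSeries Γ R}

theorem ShiftBounded.summable (hm : ShiftBounded S Λ m) (hg : g.support ⊆ Λ) :
    (⋃ γ, (g.coeff γ • m γ).support).IsPWO ∧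
      ∀ β, {γ | (g.coeff γ • m γ).coeff β ≠ 0}.Finite := by
  have key : ∀ γ β, (g.coeff γ • m γ).coeff β ≠ 0 → γ ∈ g.support ∧ β - γ ∈ S := by
    intro γ β h
    rw [coeff_smul, smul_eq_mul] at h
    have h1 : γ ∈ g.support := left_ne_zero_of_mul h
    exact ⟨h1, hm.2 γ (hg h1) β (right_ne_zero_of_mul h)⟩
  constructor
  · refine (g.isPWO_support.add hm.1).mono ?_
    intro β hβ
    obtain ⟨γ, hγ⟩ := Set.mem_iUnion.1 hβ
    obtain ⟨h1, h2⟩ := key γ β hγ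
    exact ⟨γ, h1, β - γ, h2, by simp⟩
  · intro β
    exact (finite_sub_mem g.isPWO_support hm.1 β).subset fun γ h => key γ β h

theorem exists_family_lin (hm : ShiftBounded S Λ m) (hg : g.support ⊆ Λ) :
    ∃ s : SummableFamily Γ R Γ, (∀ γ, s γ = g.coeff γ • m γ) ∧ s.hsum = lin m g := by
  have h := hm.summable hg
  refine ⟨⟨fun γ => g.coeff γ • m γ, h.1, h.2⟩, fun γ => rfl, ?_⟩
  rw [lin, dif_pos h]

omit [AddCommGroup Γ] [IsOrderedAddMonoid Γ] in
theorem hsum_eq_lin (s : SummableFamily Γ R Γ) (hs : ∀ γ, s γ = g.coeff γ • m γ) :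
    s.hsum = lin m g := by
  have h : (⋃ γ, (g.coeff γ • m γ).support).IsPWO ∧
      ∀ β, {γ | (g.coeff γ • m γ).coeff β ≠ 0}.Finite := by
    simp only [← hs]
    exact ⟨s.isPWO_iUnion_support, s.finite_co_support⟩
  rw [lin, dif_pos h]
  congr 1
  ext1 γ
  exact hs γ

theorem coeff_lin (hm : ShiftBounded S Λ m) (hg : g.support ⊆ Λ) (β : Γ) :
    (lin m g).coeff β = ∑ᶠ γ, g.coeff γ * (m γ).coeff β := by
  rw [lin, dif_pos (hm.summable hg)]
  rfl

theorem coeff_lin_eq_sum (hm : ShiftBounded S Λ m) (hg : g.support ⊆ Λ) {A : Set Γ}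
    (hA : A.IsPWO) (hgA : g.support ⊆ A) (β : Γ) :
    (lin m g).coeff β =
      ∑ γ ∈ (finite_sub_mem hA hm.1 β).toFinset, g.coeff γ * (m γ).coeff β := by
  rw [coeff_lin hm hg]
  refine finsum_eq_sum_of_support_subset _ ?_
  intro γ hγ
  have h1 : γ ∈ g.support := left_ne_zero_of_mul hγ
  simpa using ⟨hgA h1, hm.2 γ (hg h1) β (right_ne_zero_of_mul hγ)⟩

theorem support_lin (hm : ShiftBounded S Λ m) (hg : g.support ⊆ Λ) {β : Γ}
    (hβ : β ∈ (lin m g).support) : ∃ γ ∈ g.support, β - γ ∈ S := by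
  rw [mem_support, coeff_lin hm hg] at hβ
  obtain ⟨γ, hγ⟩ : ∃ γ, g.coeff γ * (m γ).coeff β ≠ 0 := by
    by_contra! h
    exact hβ (by simp [h])
  have h1 : γ ∈ g.support := left_ne_zero_of_mul hγ
  exact ⟨γ, h1, hm.2 γ (hg h1) β (right_ne_zero_of_mul hγ)⟩

omit [AddCommGroup Γ] [IsOrderedAddMonoid Γ] in
theorem lin_single (γ : Γ) (r : R) : lin m (single γ r) = r • m γ := by
  classical
  rw [← SummableFamily.hsum_single γ (r • m γ)]
  symm
  refine hsum_eq_lin _ fun γ' => ?_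
  by_cases h : γ' = γ
  · subst h; simp
  · simp [h]

/-- `lin m` commutes with infinite sums. -/
theorem lin_hsum {α : Type*} (hm : ShiftBounded S Λ m) (s : SummableFamily Γ R α)
    (hs : ∀ a, (s a).support ⊆ Λ) :
    ∃ t : SummableFamily Γ R α, (∀ a, t a = lin m (s a)) ∧ lin m s.hsum = t.hsum := by
  have hU := s.isPWO_iUnion_support
  have hsub : ∀ a, (s a).support ⊆ ⋃ a, (s a).support :=
    fun a => Set.subset_iUnion_of_subset a le_rfl
  have hF := fun β => finite_sub_mem hU hm.1 β
  have hpt : ∀ β a, (lin m (s a)).coeff β =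
      ∑ γ ∈ (hF β).toFinset, (s a).coeff γ * (m γ).coeff β := fun β a =>
    coeff_lin_eq_sum hm (hs a) hU (hsub a) β
  refine ⟨⟨fun a => lin m (s a), ?_, ?_⟩, fun a => rfl, ?_⟩
  · refine (hU.add hm.1).mono ?_
    intro β hβ
    obtain ⟨a, ha⟩ := Set.mem_iUnion.1 hβ
    obtain ⟨γ, h1, h2⟩ := support_lin hm (hs a) ha
    exact ⟨γ, hsub a h1, β - γ, h2, by simp⟩
  · intro β
    refine ((hF β).biUnion fun γ _ => s.finite_co_support γ).subset ?_
    intro a ha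
    change (lin m (s a)).coeff β ≠ 0 at ha
    rw [hpt] at ha
    obtain ⟨γ, h1, h2⟩ := Finset.exists_ne_zero_of_sum_ne_zero ha
    simp only [Set.mem_iUnion]
    exact ⟨γ, by simpa using h1, left_ne_zero_of_mul h2⟩
  · have hsΛ : s.hsum.support ⊆ Λ := s.support_hsum_subset.trans (Set.iUnion_subset hs)
    ext β
    rw [coeff_lin_eq_sum hm hsΛ hU s.support_hsum_subset]
    simp only [SummableFamily.coeff_hsum, SummableFamily.coe_mk, hpt]
    rw [finsum_sum_comm]
    · refine Finset.sum_congr rfl fun γ _ => ?_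
      rw [finsum_mul' _ _ (s.finite_co_support γ)]
    · intro γ _
      refine (s.finite_co_support γ).subset ?_
      intro a ha
      exact left_ne_zero_of_mul ha

theorem lin_add (hm : ShiftBounded S Λ m) {g g' : HahnSeries Γ R} (hg : g.support ⊆ Λ)
    (hg' : g'.support ⊆ Λ) : lin m (g + g') = lin m g + lin m g' := by
  obtain ⟨s, hs, hs'⟩ := exists_family_lin hm hg
  obtain ⟨t, ht, ht'⟩ := exists_family_lin hm hg'
  rw [← hs', ← ht', ← SummableFamily.hsum_add]
  symm
  apply hsum_eq_lin
  intro γ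
  simp [hs, ht, add_smul]

theorem lin_smul (hm : ShiftBounded S Λ m) (hg : g.support ⊆ Λ) (r : R) :
    lin m (r • g) = r • lin m g := by
  obtain ⟨s, hs, hs'⟩ := exists_family_lin hm hg
  have : lin m (r • g) = (r • s).hsum := by
    symm
    apply hsum_eq_lin
    intro γ
    simp [hs, mul_smul]
  rw [this, ← hs']
  ext β
  simp only [SummableFamily.coeff_hsum, SummableFamily.coe_smul', Pi.smul_apply, coeff_smul]
  rw [smul_finsum' _ (s.finite_co_support β)]

theorem lin_neg (hm : ShiftBounded S Λ m) (hg : g.support ⊆ Λ) : lin m (-g) = -lin m g := by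
  simpa using lin_smul hm hg (-1)

theorem lin_sub (hm : ShiftBounded S Λ m) {g g' : HahnSeries Γ R} (hg : g.support ⊆ Λ)
    (hg' : g'.support ⊆ Λ) : lin m (g - g') = lin m g - lin m g' := by
  rw [sub_eq_add_neg, lin_add hm hg (by simpa using hg'), lin_neg hm hg', sub_eq_add_neg]

/-- A Hahn series is the sum of its monomials. -/
theorem exists_family_monomials (g : HahnSeries Γ R) :
    ∃ s : SummableFamily Γ R Γ, (∀ γ, s γ = single γ (g.coeff γ)) ∧ s.hsum = g := by
  have hm : ShiftBounded {0} Set.univ (fun γ : Γ => (single γ 1 : HahnSeries Γ R)) := by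
    refine ⟨Set.isPWO_singleton 0, fun γ _ β hβ => ?_⟩
    simp [eq_of_mem_support_single hβ]
  obtain ⟨s, hs, hs'⟩ := exists_family_lin hm (Set.subset_univ g.support)
  have hs2 : ∀ γ, s γ = single γ (g.coeff γ) := by
    intro γ; rw [hs]; ext β; simp [coeff_single]
  refine ⟨s, hs2, ?_⟩
  ext β
  rw [SummableFamily.coeff_hsum, finsum_eq_single _ β]
  · simp [hs2]
  · intro γ hγ
    rw [hs2, coeff_single_of_ne hγ.symm]

theorem support_mul_subset_of_mem {L : AddSubmonoid Γ} {x y : HahnSeries Γ R}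
    (hx : x.support ⊆ L) (hy : y.support ⊆ L) : (x * y).support ⊆ L := by
  intro γ h
  obtain ⟨a, ha, b, hb, rfl⟩ := support_mul_subset h
  exact L.add_mem (hx ha) (hy hb)

omit [IsOrderedAddMonoid Γ] in
theorem support_one_subset (L : AddSubmonoid Γ) : (1 : HahnSeries Γ R).support ⊆ L := by
  intro γ h
  rw [eq_of_mem_support_single h]
  exact L.zero_mem

theorem support_pow_subset_of_mem {L : AddSubmonoid Γ} {x : HahnSeries Γ R}
    (hx : x.support ⊆ L) (n : ℕ) : (x ^ n).support ⊆ L := by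
  induction n with
  | zero => simpa using support_one_subset L
  | succ n ih => rw [pow_succ]; exact support_mul_subset_of_mem ih hx

theorem lin_mul {L : AddSubmonoid Γ} (hm : ShiftBounded S L m)
    (hmul : ∀ γ ∈ L, ∀ γ' ∈ L, m (γ + γ') = m γ * m γ') {g g' : HahnSeries Γ R}
    (hg : g.support ⊆ L) (hg' : g'.support ⊆ L) : lin m (g * g') = lin m g * lin m g' := by
  obtain ⟨s, hs, hs'⟩ := exists_family_monomials g
  obtain ⟨t, ht, ht'⟩ := exists_family_monomials g'
  have hsL : ∀ γ, (s γ).support ⊆ L := by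
    intro γ β hβ
    rw [hs] at hβ
    have := eq_of_mem_support_single hβ
    subst this
    exact hg (by simpa using hβ)
  have htL : ∀ γ, (t γ).support ⊆ L := by
    intro γ β hβ
    rw [ht] at hβ
    have := eq_of_mem_support_single hβ
    subst this
    exact hg' (by simpa using hβ)
  obtain ⟨u, hu, hu'⟩ := lin_hsum hm (s.mul t) fun a => by
    simpa using support_mul_subset_of_mem (hsL a.1) (htL a.2)
  obtain ⟨s1, hs1, hs1'⟩ := lin_hsum hm s hsL
  obtain ⟨t1, ht1, ht1'⟩ := lin_hsum hm t htL
  have h1 : lin m (g * g') = u.hsum := by rw [← hu', SummableFamily.hsum_mul, hs', ht']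
  have h2 : lin m g * lin m g' = (s1.mul t1).hsum := by
    rw [SummableFamily.hsum_mul, ← hs1', ← ht1', hs', ht']
  rw [h1, h2]
  congr 1
  ext1 ⟨a, b⟩
  rw [hu, SummableFamily.mul_toFun, SummableFamily.mul_toFun, hs1, ht1]
  simp only [hs, ht, single_mul_single, lin_single]
  by_cases ha : g.coeff a = 0
  · simp [ha]
  by_cases hb : g'.coeff b = 0
  · simp [hb]
  rw [hmul a (hg ha) b (hg' hb), smul_mul_smul_comm]

theorem lin_pow {L : AddSubmonoid Γ} (hm : ShiftBounded S L m) (h0 : m 0 = 1)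
    (hmul : ∀ γ ∈ L, ∀ γ' ∈ L, m (γ + γ') = m γ * m γ') (hg : g.support ⊆ L) (n : ℕ) :
    lin m (g ^ n) = lin m g ^ n := by
  induction n with
  | zero =>
    rw [pow_zero, pow_zero]
    nth_rw 1 [← single_zero_one]
    rw [lin_single, h0, one_smul]
  | succ n ih =>
    rw [pow_succ, pow_succ, lin_mul hm hmul (support_pow_subset_of_mem hg n) hg, ih]

theorem lin_heval {L : AddSubmonoid Γ} (hm : ShiftBounded S L m) (h0 : m 0 = 1)
    (hmul : ∀ γ ∈ L, ∀ γ' ∈ L, m (γ + γ') = m γ * m γ') (hg : g.support ⊆ L)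
    (hgpos : 0 < g.orderTop) (hlin : 0 < (lin m g).orderTop) (P : PowerSeries R) :
    lin m (PowerSeries.heval g P) = PowerSeries.heval (lin m g) P := by
  obtain ⟨t, ht, ht'⟩ := lin_hsum hm (SummableFamily.powerSeriesFamily g P) fun n => by
    rw [SummableFamily.powerSeriesFamily_of_orderTop_pos hgpos]
    exact (support_smul_subset _ _).trans (support_pow_subset_of_mem hg n)
  rw [PowerSeries.heval_apply, PowerSeries.heval_apply, ht']
  congr 1
  ext1 n
  rw [ht, SummableFamily.powerSeriesFamily_of_orderTop_pos hgpos,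
    SummableFamily.powerSeriesFamily_of_orderTop_pos hlin,
    lin_smul hm (support_pow_subset_of_mem hg n), lin_pow hm h0 hmul hg]

end Kernel

/-! ### Substitution into power series -/

section PowerSeries

variable {Γ : Type*} [AddCommGroup Γ] [LinearOrder Γ] [IsOrderedAddMonoid Γ]
  {R R' : Type*} [CommRing R] [CommRing R']

/-- Application of a ring homomorphism to all coefficients. -/
noncomputable def mapHom (φ : R →+* R') : HahnSeries Γ R →+* HahnSeries Γ R' where
  toFun x := x.map φ
  map_one' := HahnSeries.map_one φ.toMonoidWithZeroHom
  map_mul' _ _ := HahnSeries.map_mul (φ : R →ₙ+* R')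
  map_zero' := HahnSeries.map_zero (φ : ZeroHom R R')
  map_add' _ _ := HahnSeries.map_add (φ : R →+ R')

@[simp]
theorem coeff_mapHom (φ : R →+* R') (x : HahnSeries Γ R) (γ : Γ) :
    (mapHom φ x).coeff γ = φ (x.coeff γ) := rfl

@[simp]
theorem mapHom_single (φ : R →+* R') (γ : Γ) (r : R) :
    mapHom φ (single γ r) = single γ (φ r) := by
  ext β
  by_cases h : β = γ
  · subst h; simp
  · simp [coeff_single_of_ne h]

theorem support_mapHom (φ : R →+* R') (x : HahnSeries Γ R) :
    (mapHom φ x).support ⊆ x.support := by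
  intro γ h h'
  exact h (by simp [h'])

theorem orderTop_mapHom_pos (φ : R →+* R') {x : HahnSeries Γ R} (hx : 0 < x.orderTop) :
    0 < (mapHom φ x).orderTop :=
  orderTop_pos_iff.2 fun γ h => orderTop_pos_iff.1 hx γ (support_mapHom φ x h)

theorem mapHom_heval (φ : R →+* R') {x : HahnSeries Γ R} (hx : 0 < x.orderTop)
    (P : PowerSeries R) :
    mapHom φ (PowerSeries.heval x P) = PowerSeries.heval (mapHom φ x) (PowerSeries.map φ P) := by
  ext γ
  rw [coeff_mapHom, PowerSeries.heval_apply, PowerSeries.heval_apply,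
    SummableFamily.coeff_hsum, SummableFamily.coeff_hsum]
  have h := (SummableFamily.powerSeriesFamily x P).finite_co_support γ
  rw [show φ (∑ᶠ n, ((SummableFamily.powerSeriesFamily x P) n).coeff γ) =
    (φ : R →+ R') (∑ᶠ n, ((SummableFamily.powerSeriesFamily x P) n).coeff γ) from rfl,
    AddMonoidHom.map_finsum _ h]
  refine finsum_congr fun n => ?_
  rw [SummableFamily.powerSeriesFamily_of_orderTop_pos hx,
    SummableFamily.powerSeriesFamily_of_orderTop_pos (orderTop_mapHom_pos φ hx), ← map_pow]
  simp only [coeff_smul, smul_eq_mul, PowerSeries.coeff_map, coeff_mapHom]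
  exact map_mul φ _ _

theorem mapHom_lin {S Λ : Set Γ} {m : Γ → HahnSeries Γ R} (φ : R →+* R')
    (hm : ShiftBounded S Λ m) {g : HahnSeries Γ R} (hg : g.support ⊆ Λ) :
    mapHom φ (lin m g) = lin (fun γ => mapHom φ (m γ)) (mapHom φ g) := by
  have hm' : ShiftBounded S Λ (fun γ => mapHom φ (m γ)) :=
    ⟨hm.1, fun γ hγ β hβ => hm.2 γ hγ β (support_mapHom φ _ hβ)⟩
  ext β
  rw [coeff_mapHom, coeff_lin_eq_sum hm hg g.isPWO_support le_rfl,
    coeff_lin_eq_sum hm' ((support_mapHom φ g).trans hg) g.isPWO_support (support_mapHom φ g)]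
  simp

theorem orderTop_pos_add {x y : HahnSeries Γ R} (hx : 0 < x.orderTop) (hy : 0 < y.orderTop) :
    0 < (x + y).orderTop := by
  rw [orderTop_pos_iff] at *
  intro γ h
  rcases support_add_subset _ _ h with h | h
  exacts [hx γ h, hy γ h]

omit [IsOrderedAddMonoid Γ] in
theorem orderTop_pos_neg {x : HahnSeries Γ R} (hx : 0 < x.orderTop) : 0 < (-x).orderTop := by
  rwa [orderTop_neg]

theorem orderTop_pos_sub {x y : HahnSeries Γ R} (hx : 0 < x.orderTop) (hy : 0 < y.orderTop) :
    0 < (x - y).orderTop := by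
  rw [sub_eq_add_neg]
  exact orderTop_pos_add hx (orderTop_pos_neg hy)

theorem orderTop_pos_mul {x y : HahnSeries Γ R} (hx : 0 < x.orderTop)
    (hy : ∀ γ ∈ y.support, 0 ≤ γ) : 0 < (x * y).orderTop := by
  rw [orderTop_pos_iff] at *
  intro γ h
  obtain ⟨a, ha, b, hb, rfl⟩ := support_mul_subset h
  exact add_pos_of_pos_of_nonneg (hx a ha) (hy b hb)

theorem nonneg_of_orderTop_pos {x : HahnSeries Γ R} (hx : 0 < x.orderTop) :
    ∀ γ ∈ x.support, 0 ≤ γ := fun γ h => (orderTop_pos_iff.1 hx γ h).le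

theorem orderTop_single_pos {γ : Γ} (hγ : 0 < γ) (r : R) : 0 < (single γ r).orderTop :=
  orderTop_pos_iff.2 fun β hβ => by rwa [eq_of_mem_support_single hβ]

theorem support_heval_subset {L : AddSubmonoid Γ} {x : HahnSeries Γ R} (hx : x.support ⊆ L)
    (P : PowerSeries R) : (PowerSeries.heval x P).support ⊆ L := by
  rw [PowerSeries.heval_apply]
  refine (SummableFamily.support_hsum_subset).trans (Set.iUnion_subset fun n => ?_)
  rw [SummableFamily.smulFamily_toFun]
  refine (support_smul_subset _ _).trans ?_
  rw [SummableFamily.powers_toFun]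
  split_ifs
  · exact support_pow_subset_of_mem hx n
  · exact support_pow_subset_of_mem (by simp) n

/-- The submonoid of nonnegative exponents. -/
def nonnegSubmonoid (Γ : Type*) [AddCommGroup Γ] [LinearOrder Γ] [IsOrderedAddMonoid Γ] :
    AddSubmonoid Γ where
  carrier := {γ | 0 ≤ γ}
  zero_mem' := le_refl (0 : Γ)
  add_mem' := fun {a b} (ha : 0 ≤ a) (hb : 0 ≤ b) => add_nonneg ha hb

theorem nonneg_heval {x : HahnSeries Γ R} (hx : 0 < x.orderTop) (P : PowerSeries R) :
    ∀ γ ∈ (PowerSeries.heval x P).support, 0 ≤ γ := fun _ h =>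
  support_heval_subset (L := nonnegSubmonoid Γ) (nonneg_of_orderTop_pos hx) P h

theorem heval_eq_add {x : HahnSeries Γ R} (hx : 0 < x.orderTop) (P : PowerSeries R) :
    ∃ y, (∀ γ ∈ y.support, 0 ≤ γ) ∧
      PowerSeries.heval x P = C (PowerSeries.constantCoeff P) + x * y := by
  refine ⟨PowerSeries.heval x (PowerSeries.mk fun n => PowerSeries.coeff (n + 1) P),
    nonneg_heval hx _, ?_⟩
  conv_lhs => rw [PowerSeries.eq_X_mul_shift_add_const P]
  rw [map_add, map_mul, PowerSeries.heval_X _ hx, PowerSeries.heval_C, add_comm,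
    ← C_mul_eq_smul, mul_one]

theorem heval_eq_add_mul {x : HahnSeries Γ R} (hx : 0 < x.orderTop) (P : PowerSeries R) :
    ∃ η, 0 < η.orderTop ∧ PowerSeries.heval x P =
      C (PowerSeries.constantCoeff P) + x * (C (PowerSeries.coeff 1 P) + η) := by
  obtain ⟨y, hy, h⟩ := heval_eq_add hx (PowerSeries.mk fun n => PowerSeries.coeff (n + 1) P)
  refine ⟨x * y, orderTop_pos_mul hx hy, ?_⟩
  conv_lhs => rw [PowerSeries.eq_X_mul_shift_add_const P]
  rw [map_add, map_mul, PowerSeries.heval_X _ hx, PowerSeries.heval_C, add_comm,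
    ← C_mul_eq_smul, mul_one, h]
  rw [← PowerSeries.coeff_zero_eq_constantCoeff_apply (PowerSeries.mk _), PowerSeries.coeff_mk]

theorem orderTop_heval_pos {x : HahnSeries Γ R} (hx : 0 < x.orderTop) {P : PowerSeries R}
    (hP : PowerSeries.constantCoeff P = 0) : 0 < (PowerSeries.heval x P).orderTop := by
  obtain ⟨y, hy, h⟩ := heval_eq_add hx P
  rw [h, hP, C_zero, zero_add]
  exact orderTop_pos_mul hx hy

variable [Algebra ℝ R] [Algebra ℚ R] [Algebra ℝ R'] [Algebra ℚ R']

/-- The power `(1 + x) ^ c`, for `x` of positive order. -/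
noncomputable def pw (x : HahnSeries Γ R) (c : ℝ) : HahnSeries Γ R :=
  PowerSeries.heval x (PowerSeries.binomialSeries R c)

/-- The logarithm `log (1 + x)`, for `x` of positive order. -/
noncomputable def lg (x : HahnSeries Γ R) : HahnSeries Γ R :=
  PowerSeries.heval x (PowerSeries.log R)

omit [Algebra ℚ R] in
theorem pw_add (x : HahnSeries Γ R) (c d : ℝ) : pw x (c + d) = pw x c * pw x d := by
  rw [pw, PowerSeries.binomialSeries_add, map_mul, pw, pw]

omit [Algebra ℚ R] in
@[simp]
theorem pw_zero (x : HahnSeries Γ R) : pw x 0 = 1 := by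
  rw [pw, PowerSeries.binomialSeries_zero, map_one]

omit [Algebra ℚ R] in
theorem pw_natCast {x : HahnSeries Γ R} (hx : 0 < x.orderTop) (n : ℕ) :
    pw x n = (1 + x) ^ n := by
  rw [pw, PowerSeries.binomialSeries_nat, map_pow, map_add, map_one, PowerSeries.heval_X _ hx]

omit [Algebra ℚ R] in
theorem pw_one {x : HahnSeries Γ R} (hx : 0 < x.orderTop) : pw x 1 = 1 + x := by
  simpa using pw_natCast hx 1

omit [Algebra ℚ R] in
theorem pw_neg_one_mul {x : HahnSeries Γ R} (hx : 0 < x.orderTop) :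
    pw x (-1) * (1 + x) = 1 := by
  rw [← pw_one hx, ← pw_add]
  simp

omit [Algebra ℚ R] in
theorem pw_eq {x : HahnSeries Γ R} (hx : 0 < x.orderTop) (c : ℝ) :
    ∃ η, 0 < η.orderTop ∧ pw x c = 1 + x * (C (algebraMap ℝ R c) + η) := by
  obtain ⟨η, h1, h2⟩ := heval_eq_add_mul hx (PowerSeries.binomialSeries R c)
  refine ⟨η, h1, ?_⟩
  rw [pw, h2]
  simp [Algebra.algebraMap_eq_smul_one]

omit [Algebra ℝ R] in
theorem lg_eq {x : HahnSeries Γ R} (hx : 0 < x.orderTop) :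
    ∃ η, 0 < η.orderTop ∧ lg x = x * (1 + η) := by
  obtain ⟨η, h1, h2⟩ := heval_eq_add_mul hx (PowerSeries.log R)
  refine ⟨η, h1, ?_⟩
  rw [lg, h2]
  simp

omit [Algebra ℝ R] in
theorem orderTop_lg_pos {x : HahnSeries Γ R} (hx : 0 < x.orderTop) : 0 < (lg x).orderTop :=
  orderTop_heval_pos hx (by simp)

omit [Algebra ℚ R] [Algebra ℚ R'] in
theorem mapHom_pw (φ : R →ₐ[ℝ] R') {x : HahnSeries Γ R} (hx : 0 < x.orderTop) (c : ℝ) :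
    mapHom (φ : R →+* R') (pw x c) = pw (mapHom (φ : R →+* R') x) c := by
  rw [pw, mapHom_heval _ hx, pw]
  congr 1
  ext n
  simp

omit [Algebra ℝ R] [Algebra ℝ R'] in
theorem mapHom_lg (φ : R →+* R') {x : HahnSeries Γ R} (hx : 0 < x.orderTop) :
    mapHom φ (lg x) = lg (mapHom φ x) := by
  rw [lg, mapHom_heval _ hx, lg, PowerSeries.map_log]

/-- An identity between series with polynomial coefficients may be checked at natural numbers. -/
theorem mapHom_eval_ext {F G : HahnSeries Γ (Polynomial ℝ)}
    (h : ∀ n : ℕ, mapHom (Polynomial.evalRingHom (n : ℝ)) F =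
      mapHom (Polynomial.evalRingHom (n : ℝ)) G) : F = G := by
  ext1
  funext γ
  refine Polynomial.eq_of_infinite_eval_eq _ _ ?_
  refine (Set.infinite_range_of_injective (f := ((↑) : ℕ → ℝ)) Nat.cast_injective).mono ?_
  rintro _ ⟨n, rfl⟩
  have := congrArg (fun F => F.coeff γ) (h n)
  simpa using this

open Polynomial in
/-- The binomial coefficient `choose c n` as a polynomial in `c`. -/
noncomputable def choosePoly (n : ℕ) : ℝ[X] :=
  Polynomial.C ((n.factorial : ℝ)⁻¹) * descPochhammer ℝ n

theorem eval_choosePoly (n : ℕ) (c : ℝ) : (choosePoly n).eval c = Ring.choose c n := by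
  rw [choosePoly, Ring.choose_eq_smul, Polynomial.eval_mul, Polynomial.eval_C, smul_eq_mul,
    ← descPochhammer_map (Int.castRingHom ℝ), Polynomial.eval_map,
    ← Polynomial.eval₂_smulOneHom_eq_smeval]
  congr 2
  exact Subsingleton.elim _ _

/-- The power `(1 + x) ^ c` as a series with coefficients polynomial in `c`. -/
noncomputable def pwPoly (x : HahnSeries Γ ℝ) : HahnSeries Γ (Polynomial ℝ) :=
  PowerSeries.heval (mapHom Polynomial.C x) (PowerSeries.mk choosePoly)

theorem mapHom_eval_pwPoly {x : HahnSeries Γ ℝ} (hx : 0 < x.orderTop) (c : ℝ) :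
    mapHom (Polynomial.evalRingHom c) (pwPoly x) = pw x c := by
  rw [pwPoly, mapHom_heval _ (orderTop_mapHom_pos _ hx), pw]
  congr 2
  · ext γ; simp
  · ext n; simp [eval_choosePoly]

omit [Algebra ℝ R] [Algebra ℚ R] in
theorem orderTop_pos_one_add_mul {x y : HahnSeries Γ R} (hx : 0 < x.orderTop)
    (hy : 0 < y.orderTop) : 0 < (x + y + x * y).orderTop :=
  orderTop_pos_add (orderTop_pos_add hx hy) (orderTop_pos_mul hx (nonneg_of_orderTop_pos hy))

/-- For natural exponents this is `((1 + x) (1 + y)) ^ n = (1 + x) ^ n (1 + y) ^ n`; the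
coefficients are polynomials in the exponent. -/
theorem pwPoly_mul {x y : HahnSeries Γ ℝ} (hx : 0 < x.orderTop) (hy : 0 < y.orderTop) :
    pwPoly (x + y + x * y) = pwPoly x * pwPoly y := by
  refine mapHom_eval_ext fun n => ?_
  rw [map_mul, mapHom_eval_pwPoly hx, mapHom_eval_pwPoly hy,
    mapHom_eval_pwPoly (orderTop_pos_one_add_mul hx hy), pw_natCast hx, pw_natCast hy,
    pw_natCast (orderTop_pos_one_add_mul hx hy), ← mul_pow]
  ring

theorem pw_mul {x y : HahnSeries Γ ℝ} (hx : 0 < x.orderTop) (hy : 0 < y.orderTop) (c : ℝ) :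
    pw (x + y + x * y) c = pw x c * pw y c := by
  rw [← mapHom_eval_pwPoly hx, ← mapHom_eval_pwPoly hy,
    ← mapHom_eval_pwPoly (orderTop_pos_one_add_mul hx hy), pwPoly_mul hx hy, map_mul]

/-- The evaluation of polynomials at the dual number `ε`, that is the first-order jet at `0`. -/
noncomputable def jet : Polynomial ℝ →+* DualNumber ℝ :=
  (Polynomial.aeval (DualNumber.eps : DualNumber ℝ) : Polynomial ℝ →ₐ[ℝ] DualNumber ℝ)

theorem jet_descPochhammer (n : ℕ) :
    jet (descPochhammer ℝ (n + 1)) =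
      (TrivSqZeroExt.inl ((-1) ^ n * n.factorial) : DualNumber ℝ) * DualNumber.eps := by
  induction n with
  | zero => simp [jet]
  | succ n ih =>
    rw [descPochhammer_succ_right, map_mul, ih]
    have h : jet (Polynomial.X - ((n + 1 : ℕ) : Polynomial ℝ)) =
        DualNumber.eps - TrivSqZeroExt.inl ((n + 1 : ℕ) : ℝ) := by
      simp [jet]
    rw [h, mul_sub, mul_assoc _ DualNumber.eps DualNumber.eps, DualNumber.eps_mul_eps]
    ext
    · simp
    · simp [Nat.factorial_succ, pow_succ]; ring

theorem jet_choosePoly (n : ℕ) :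
    jet (choosePoly n) = (PowerSeries.coeff n (1 : PowerSeries (DualNumber ℝ))) +
      TrivSqZeroExt.inl (PowerSeries.coeff n (PowerSeries.log ℝ)) * DualNumber.eps := by
  rcases n with _ | n
  · simp [choosePoly]
  · rw [choosePoly, map_mul, jet_descPochhammer]
    have h : jet (Polynomial.C (((n + 1).factorial : ℝ)⁻¹)) =
        TrivSqZeroExt.inl (((n + 1).factorial : ℝ)⁻¹) := by
      simp [jet, TrivSqZeroExt.algebraMap_eq_inl]
    rw [h]
    ext
    · simp [PowerSeries.coeff_one]
    · simp [PowerSeries.coeff_one, Nat.factorial_succ, pow_succ]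
      field_simp

/-- The derivative of `(1 + x) ^ c` at `c = 0` is `log (1 + x)`. -/
theorem jet_pwPoly {x : HahnSeries Γ ℝ} (hx : 0 < x.orderTop) :
    mapHom jet (pwPoly x) =
      1 + mapHom (TrivSqZeroExt.inlHom ℝ ℝ) (lg x) * C (DualNumber.eps : DualNumber ℝ) := by
  have hx' := orderTop_mapHom_pos (TrivSqZeroExt.inlHom ℝ ℝ) hx
  rw [pwPoly, mapHom_heval _ (orderTop_mapHom_pos _ hx), lg, mapHom_heval _ hx]
  have h1 : mapHom jet (mapHom Polynomial.C x) = mapHom (TrivSqZeroExt.inlHom ℝ ℝ) x := by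
    ext1; funext γ
    simp [jet, TrivSqZeroExt.algebraMap_eq_inl]
  have h2 : PowerSeries.map jet (PowerSeries.mk choosePoly) =
      1 + (DualNumber.eps : DualNumber ℝ) •
        PowerSeries.map (TrivSqZeroExt.inlHom ℝ ℝ) (PowerSeries.log ℝ) := by
    ext1 n
    rw [PowerSeries.coeff_map, PowerSeries.coeff_mk, jet_choosePoly, map_add,
      PowerSeries.coeff_smul, PowerSeries.coeff_map, smul_eq_mul, mul_comm]
    rfl
  rw [h1, h2, map_add, map_one, map_smul, mul_comm, C_mul_eq_smul]

/-- `log ((1 + x) (1 + y)) = log (1 + x) + log (1 + y)`: the derivative at `c = 0` of the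
multiplicativity of `(1 + x) ^ c`. -/
theorem lg_mul {x y : HahnSeries Γ ℝ} (hx : 0 < x.orderTop) (hy : 0 < y.orderTop) :
    lg (x + y + x * y) = lg x + lg y := by
  have h := congrArg (mapHom jet) (pwPoly_mul hx hy)
  rw [map_mul, jet_pwPoly hx, jet_pwPoly hy, jet_pwPoly (orderTop_pos_one_add_mul hx hy)] at h
  have he : (C (DualNumber.eps : DualNumber ℝ) : HahnSeries Γ (DualNumber ℝ)) * C DualNumber.eps
      = 0 := by
    rw [← map_mul, DualNumber.eps_mul_eps, map_zero]
  have h2 : mapHom (TrivSqZeroExt.inlHom ℝ ℝ) (lg (x + y + x * y)) * C DualNumber.eps =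
      mapHom (TrivSqZeroExt.inlHom ℝ ℝ) (lg x + lg y) * C (DualNumber.eps : DualNumber ℝ) := by
    rw [map_add]
    linear_combination h + mapHom (TrivSqZeroExt.inlHom ℝ ℝ) (lg x) *
      mapHom (TrivSqZeroExt.inlHom ℝ ℝ) (lg y) * he
  ext γ
  have h3 := congrArg (fun F => TrivSqZeroExt.snd (F.coeff γ)) h2
  simpa [mul_comm _ (C (DualNumber.eps : DualNumber ℝ)), C_mul_eq_smul] using h3

end PowerSeries

/-! ### Exponents -/

theorem unitExp_apply (k j : ℕ) : ofLex (unitExp k) j = if k = j then 1 else 0 := by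
  simp [unitExp, Finsupp.single_apply]

theorem exponent_add_apply (γ γ' : Exponent) (j : ℕ) :
    ofLex (γ + γ') j = ofLex γ j + ofLex γ' j := rfl

theorem exponent_sub_apply (γ γ' : Exponent) (j : ℕ) :
    ofLex (γ - γ') j = ofLex γ j - ofLex γ' j := rfl

theorem exponent_neg_apply (γ : Exponent) (j : ℕ) : ofLex (-γ) j = -ofLex γ j := rfl

theorem exponent_zero_apply (j : ℕ) : ofLex (0 : Exponent) j = 0 := rfl

theorem exponent_ext {γ γ' : Exponent} (h : ∀ j, ofLex γ j = ofLex γ' j) : γ = γ' :=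
  Finsupp.ext (f := ofLex γ) (g := ofLex γ') h

theorem exponent_lt_iff {γ γ' : Exponent} :
    γ < γ' ↔ ∃ i, (∀ j < i, ofLex γ j = ofLex γ' j) ∧ ofLex γ i < ofLex γ' i :=
  Finsupp.Lex.lt_iff

theorem apply_zero_le_of_le {γ γ' : Exponent} (h : γ ≤ γ') : ofLex γ 0 ≤ ofLex γ' 0 := by
  rcases h.eq_or_lt with rfl | h
  · rfl
  · obtain ⟨i, h1, h2⟩ := exponent_lt_iff.1 h
    rcases Nat.eq_zero_or_pos i with rfl | hi
    · exact h2.le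
    · exact (h1 0 hi).le

theorem apply_one_le_of_le {γ γ' : Exponent} (h : γ ≤ γ') (h0 : ofLex γ 0 = ofLex γ' 0) :
    ofLex γ 1 ≤ ofLex γ' 1 := by
  rcases h.eq_or_lt with rfl | h
  · rfl
  · obtain ⟨i, h1, h2⟩ := exponent_lt_iff.1 h
    rcases i with _ | _ | i
    · exact absurd h0 h2.ne
    · exact h2.le
    · exact (h1 1 (by omega)).le

theorem unitExp_pos (k : ℕ) : 0 < unitExp k := by
  rw [exponent_lt_iff]
  refine ⟨k, fun j hj => ?_, ?_⟩
  · rw [unitExp_apply, if_neg (by omega), exponent_zero_apply]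
  · rw [unitExp_apply, if_pos rfl, exponent_zero_apply]
    exact one_pos

/-- The exponent of `ℓ₁ ⋯ ℓ_k`. -/
noncomputable def sig (k : ℕ) : Exponent := ∑ i ∈ Finset.range k, unitExp (i + 1)

@[simp]
theorem sig_zero : sig 0 = 0 := by simp [sig]

theorem sig_succ (k : ℕ) : sig (k + 1) = sig k + unitExp (k + 1) := by
  rw [sig, Finset.sum_range_succ, ← sig]

theorem sig_one : sig 1 = unitExp 1 := by rw [sig_succ, sig_zero, zero_add]

theorem sig_strictMono : StrictMono sig :=
  strictMono_nat_of_lt_succ fun k => by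
    rw [sig_succ]
    exact lt_add_of_pos_right _ (unitExp_pos _)

theorem sig_apply (k j : ℕ) : ofLex (sig k) j = if 1 ≤ j ∧ j ≤ k then 1 else 0 := by
  induction k with
  | zero =>
    rw [sig_zero, exponent_zero_apply, if_neg (by omega)]
  | succ k ih =>
    rw [sig_succ, exponent_add_apply, ih, unitExp_apply]
    split_ifs <;> first | omega | simp

/-- `k` is the least index with nonzero entry in `γ`. -/
def IsLead (γ : Exponent) (k : ℕ) : Prop := ofLex γ k ≠ 0 ∧ ∀ j < k, ofLex γ j = 0

theorem exists_isLead {γ : Exponent} (h : γ ≠ 0) : ∃ k, IsLead γ k := by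
  classical
  have h1 : ∃ k, ofLex γ k ≠ 0 := by
    by_contra! h'
    exact h (exponent_ext h')
  exact ⟨Nat.find h1, Nat.find_spec h1, fun j hj => not_not.1 (Nat.find_min h1 hj)⟩

/-- Passing from a monomial to the leading exponent of its logarithmic derivative preserves the
order of monomials. -/
theorem add_sig_lt {γ γ' : Exponent} {k k' : ℕ} (h : γ < γ') (hk : IsLead γ k)
    (hk' : IsLead γ' k') : γ + sig k < γ' + sig k' := by
  rcases le_or_gt k k' with hkk | hkk
  · exact add_lt_add_of_lt_of_le h (sig_strictMono.monotone hkk)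
  · obtain ⟨i, h1, h2⟩ := exponent_lt_iff.1 h
    have hi : i = k' := by
      rcases lt_trichotomy i k' with hi | hi | hi
      · rw [hk.2 i (hi.trans hkk), hk'.2 i hi] at h2
        exact absurd h2 (lt_irrefl _)
      · exact hi
      · exact absurd ((h1 k' hi).symm.trans (hk.2 k' hkk)) hk'.1
    subst hi
    rw [exponent_lt_iff]
    refine ⟨i, fun j hj => ?_, ?_⟩
    · rw [exponent_add_apply, exponent_add_apply, h1 j hj, sig_apply, sig_apply]
      congr 1
      split_ifs <;> first | omega | rfl
    · rw [exponent_add_apply, exponent_add_apply, sig_apply, sig_apply]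
      have : (1 ≤ i ∧ i ≤ k) ↔ (1 ≤ i ∧ i ≤ i) := by omega
      simpa only [this] using add_lt_add_left h2 _

/-- The exponents of monomials in `ℓ₀, …, ℓ_N`. -/
def depth (N : ℕ) : AddSubgroup Exponent where
  carrier := {γ | ∀ k, N < k → ofLex γ k = 0}
  zero_mem' := fun _ _ => rfl
  add_mem' := fun ha hb k hk => by rw [exponent_add_apply, ha k hk, hb k hk, add_zero]
  neg_mem' := fun ha k hk => by rw [exponent_neg_apply, ha k hk, neg_zero]

theorem depth_mono {N N' : ℕ} (h : N ≤ N') : depth N ≤ depth N' :=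
  fun _ hγ k hk => hγ k (h.trans_lt hk)

theorem unitExp_mem_depth {k N : ℕ} (h : k ≤ N) : unitExp k ∈ depth N := fun j hj => by
  rw [unitExp_apply, if_neg (by omega)]

/-! ### Supports of depth one -/

/-- Sets of exponents of monomials `x ^ r ℓ₁ ^ n`, `n ∈ ℤ`, such that below every bound on `r` there
are only finitely many values of `r` and `n` is bounded below. -/
structure Good (A : Set Exponent) : Prop where
  depth : ∀ γ ∈ A, γ ∈ depth 1
  int : ∀ γ ∈ A, ∃ n : ℤ, ofLex γ 1 = n
  low : ∀ M : ℝ, ∃ F : Set ℝ, F.Finite ∧ ∃ b : ℝ, ∀ γ ∈ A, ofLex γ 0 ≤ M →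
    ofLex γ 0 ∈ F ∧ b ≤ ofLex γ 1

theorem Good.mono {A B : Set Exponent} (hB : Good B) (h : A ⊆ B) : Good A :=
  ⟨fun γ hγ => hB.depth γ (h hγ), fun γ hγ => hB.int γ (h hγ), fun M => by
    obtain ⟨F, hF, b, hb⟩ := hB.low M
    exact ⟨F, hF, b, fun γ hγ => hb γ (h hγ)⟩⟩

theorem Good.union {A B : Set Exponent} (hA : Good A) (hB : Good B) : Good (A ∪ B) where
  depth := by
    rintro γ (h | h)
    exacts [hA.depth γ h, hB.depth γ h]
  int := by
    rintro γ (h | h)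
    exacts [hA.int γ h, hB.int γ h]
  low M := by
    obtain ⟨F, hF, b, hb⟩ := hA.low M
    obtain ⟨F', hF', b', hb'⟩ := hB.low M
    refine ⟨F ∪ F', hF.union hF', min b b', ?_⟩
    rintro γ (h | h) hM
    · exact ⟨Or.inl (hb γ h hM).1, (min_le_left _ _).trans (hb γ h hM).2⟩
    · exact ⟨Or.inr (hb' γ h hM).1, (min_le_right _ _).trans (hb' γ h hM).2⟩

theorem good_singleton {γ : Exponent} (h : γ ∈ depth 1) (hint : ∃ n : ℤ, ofLex γ 1 = n) :
    Good {γ} where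
  depth := by rintro _ rfl; exact h
  int := by rintro _ rfl; exact hint
  low M := ⟨{ofLex γ 0}, Set.finite_singleton _, ofLex γ 1, by rintro _ rfl _; exact ⟨rfl, le_rfl⟩⟩

theorem Good.bddBelow {A : Set Exponent} (hA : Good A) : ∃ a, ∀ γ ∈ A, a ≤ ofLex γ 0 := by
  obtain ⟨F, hF, c, hb⟩ := hA.low 0
  obtain ⟨a, ha⟩ := hF.bddBelow
  refine ⟨min a 0, fun γ hγ => ?_⟩
  rcases le_total (ofLex γ 0) 0 with h | h
  · exact (min_le_left _ _).trans (ha (hb γ hγ h).1)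
  · exact (min_le_right _ _).trans h

open scoped Pointwise in
theorem Good.add {A B : Set Exponent} (hA : Good A) (hB : Good B) : Good (A + B) where
  depth := by
    rintro _ ⟨a, ha, b, hb, rfl⟩
    exact add_mem (hA.depth a ha) (hB.depth b hb)
  int := by
    rintro _ ⟨a, ha, b, hb, rfl⟩
    obtain ⟨m, hm⟩ := hA.int a ha
    obtain ⟨n, hn⟩ := hB.int b hb
    exact ⟨m + n, by simp [hm, hn]⟩
  low M := by
    obtain ⟨a0, ha0⟩ := hA.bddBelow
    obtain ⟨b0, hb0⟩ := hB.bddBelow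
    obtain ⟨F, hF, c, hc⟩ := hA.low (M - b0)
    obtain ⟨F', hF', c', hc'⟩ := hB.low (M - a0)
    refine ⟨F + F', hF.add hF', c + c', ?_⟩
    rintro _ ⟨a, ha, b, hb, rfl⟩ h
    rw [exponent_add_apply] at h ⊢
    have h1 := ha0 a ha
    have h2 := hb0 b hb
    obtain ⟨h3, h4⟩ := hc a ha (by linarith)
    obtain ⟨h5, h6⟩ := hc' b hb (by linarith)
    exact ⟨⟨_, h3, _, h5, rfl⟩, by rw [exponent_add_apply]; linarith⟩

open scoped Pointwise in
/-- The submonoid generated by nonnegative exponents stays of this kind: below a bound on the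
exponent of `x` only boundedly many summands involve `x`, and all summands satisfy `n ≥ -K r` for
some `K`, an inequality that is stable under sums. -/
theorem Good.closure {A : Set Exponent} (hA : Good A) (hpos : ∀ γ ∈ A, 0 ≤ γ) :
    Good (AddSubmonoid.closure A : Set Exponent) where
  depth γ hγ := by
    have h : AddSubmonoid.closure A ≤ (LogTransseries.depth 1).toAddSubmonoid :=
      AddSubmonoid.closure_le.2 hA.depth
    exact h hγ
  int γ hγ := by
    induction hγ using AddSubmonoid.closure_induction with
    | mem γ h => exact hA.int γ h
    | zero => exact ⟨0, by simp⟩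
    | add a b _ _ ha hb =>
      obtain ⟨m, hm⟩ := ha
      obtain ⟨n, hn⟩ := hb
      exact ⟨m + n, by simp [hm, hn]⟩
  low M := by
    obtain ⟨F, hF, b, hb⟩ := hA.low M
    obtain ⟨δ, hδ, hδF⟩ : ∃ δ : ℝ, 0 < δ ∧ ∀ r ∈ F, 0 < r → δ ≤ r := by
      have h := (hF.subset (Set.inter_subset_left (t := Set.Ioi 0)))
      rcases (F ∩ Set.Ioi 0).eq_empty_or_nonempty with he | hne
      · refine ⟨1, one_pos, fun r hr h0 => ?_⟩
        have : r ∈ F ∩ Set.Ioi 0 := ⟨hr, h0⟩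
        simp [he] at this
      · obtain ⟨δ, h1, h2⟩ := h.exists_minimal hne
        refine ⟨δ, h1.2, fun r hr h0 => ?_⟩
        rcases le_total δ r with h | h
        · exact h
        · exact h2 ⟨hr, h0⟩ h
    have key : ∀ γ ∈ AddSubmonoid.closure A, 0 ≤ ofLex γ 0 ∧ (ofLex γ 0 ≤ M →
        (-(|b| / δ) * ofLex γ 0 ≤ ofLex γ 1 ∧
          ∃ n : ℕ, n * δ ≤ ofLex γ 0 ∧ ofLex γ 0 ∈ n • F)) := by
      intro γ hγ
      induction hγ using AddSubmonoid.closure_induction with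
      | mem γ h =>
        have h0 : 0 ≤ ofLex γ 0 := apply_zero_le_of_le (hpos γ h)
        refine ⟨h0, fun hM => ?_⟩
        obtain ⟨h1, h2⟩ := hb γ h hM
        rcases h0.eq_or_lt with h3 | h3
        · have h4 : 0 ≤ ofLex γ 1 := apply_one_le_of_le (hpos γ h) h3
          refine ⟨by rw [← h3]; simpa using h4, 0, by simp [← h3], ?_⟩
          rw [zero_smul, ← h3]
          exact Set.zero_mem_zero
        · have h4 := hδF _ h1 h3
          refine ⟨?_, 1, by simpa using h4, by simpa using h1⟩
          have h5 : |b| ≤ |b| / δ * ofLex γ 0 := by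
            rw [div_mul_eq_mul_div, le_div_iff₀ hδ]
            exact mul_le_mul_of_nonneg_left h4 (abs_nonneg b)
          have := neg_abs_le b
          linarith
      | zero =>
        refine ⟨le_rfl, fun _ => ⟨by simp, 0, by simp, ?_⟩⟩
        rw [zero_smul]
        exact Set.zero_mem_zero
      | add x y _ _ hx hy =>
        rw [exponent_add_apply, exponent_add_apply]
        refine ⟨add_nonneg hx.1 hy.1, fun hM => ?_⟩
        obtain ⟨h1, n, h2, h3⟩ := hx.2 (by linarith [hy.1])
        obtain ⟨h4, n', h5, h6⟩ := hy.2 (by linarith [hx.1])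
        refine ⟨by linarith, n + n', by push_cast; linarith, ?_⟩
        rw [add_smul]
        exact ⟨_, h3, _, h6, rfl⟩
    have hfin : ∀ n : ℕ, (n • F).Finite := by
      intro n
      induction n with
      | zero => rw [zero_smul]; exact Set.finite_zero
      | succ n ih => rw [add_smul, one_smul]; exact ih.add hF
    refine ⟨⋃ n ∈ Finset.range (⌊M / δ⌋₊ + 1), n • F,
      (Finset.range _).finite_toSet.biUnion fun n _ => hfin n, -(|b| / δ) * M, ?_⟩
    intro γ hγ hM
    obtain ⟨h0, h⟩ := key γ hγ
    obtain ⟨h1, n, h2, h3⟩ := h hM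
    constructor
    · simp only [Set.mem_iUnion]
      refine ⟨n, ?_, h3⟩
      rw [Finset.mem_range, Nat.lt_succ_iff]
      refine Nat.le_floor ?_
      rw [le_div_iff₀ hδ]
      linarith
    · have : |b| / δ * ofLex γ 0 ≤ |b| / δ * M := by gcongr
      linarith

/-- The finiteness condition in the definition of the classes `LInf j`. -/
def LowerFinite (A : Set Exponent) : Prop := ∀ (k : ℕ) (p : ℕ → ℝ) (M : ℝ),
  {r : ℝ | r ≤ M ∧ ∃ γ ∈ A, (∀ i < k, ofLex γ i = p i) ∧ ofLex γ k = r}.Finite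

theorem mem_LInf_iff {j : ℕ} {f : Transseries} :
    f ∈ LInf j ↔ f.support ⊆ depth j ∧ LowerFinite f.support := Iff.rfl

theorem LowerFinite.mono {A B : Set Exponent} (hB : LowerFinite B) (h : A ⊆ B) :
    LowerFinite A := fun k p M =>
  (hB k p M).subset fun _ ⟨hr, γ, hγ, h'⟩ => ⟨hr, γ, h hγ, h'⟩

theorem LowerFinite.insert {A : Set Exponent} (hA : LowerFinite A) (β : Exponent) :
    LowerFinite (insert β A) := fun k p M => by
  refine ((hA k p M).insert (ofLex β k)).subset ?_
  rintro r ⟨hr, γ, rfl | hγ, h1, h2⟩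
  · exact Or.inl h2.symm
  · exact Or.inr ⟨hr, γ, hγ, h1, h2⟩

theorem Good.lowerFinite {A : Set Exponent} (hA : Good A) : LowerFinite A := by
  intro k p M
  rcases k with _ | _ | k
  · obtain ⟨F, hF, b, hb⟩ := hA.low M
    refine hF.subset ?_
    rintro r ⟨hr, γ, hγ, -, rfl⟩
    exact (hb γ hγ hr).1
  · obtain ⟨F, hF, b, hb⟩ := hA.low (p 0)
    refine ((Set.finite_Icc ⌈b⌉ ⌊M⌋).image ((↑) : ℤ → ℝ)).subset ?_
    rintro r ⟨hr, γ, hγ, h0, rfl⟩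
    obtain ⟨n, hn⟩ := hA.int γ hγ
    have h1 := (hb γ hγ (h0 0 (by omega)).le).2
    simp only [zero_add] at hr ⊢
    rw [hn] at hr h1 ⊢
    exact ⟨n, ⟨Int.ceil_le.2 h1, Int.le_floor.2 hr⟩, rfl⟩
  · refine (Set.finite_singleton (0 : ℝ)).subset ?_
    rintro r ⟨hr, γ, hγ, h0, rfl⟩
    exact hA.depth γ hγ _ (by omega)

/-- For integer exponents of `ℓ₁`, the finiteness conditions of `LInf 1` amount to the uniform
bounds of `Good`. -/
theorem mem_LHat_iff {f : Transseries} :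
    f ∈ LHat ↔ Good f.support ∧ ∀ γ ∈ f.support, 0 < ofLex γ 0 := by
  constructor
  · rintro ⟨⟨h1, h2⟩, h3⟩
    refine ⟨⟨h1, fun γ hγ => (h3 γ hγ).2, fun M => ?_⟩, fun γ hγ => (h3 γ hγ).1⟩
    have hb : ∀ r : ℝ, ∃ b : ℝ, ∀ γ ∈ f.support, ofLex γ 0 = r → b ≤ ofLex γ 1 := by
      intro r
      obtain ⟨b, hb⟩ := (h2 1 (fun _ => r) 0).bddBelow
      refine ⟨min b 0, fun γ hγ h => ?_⟩
      rcases le_total (ofLex γ 1) 0 with h' | h'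
      · refine (min_le_left _ _).trans (hb ⟨h', γ, hγ, ?_, rfl⟩)
        intro i hi
        rw [Nat.lt_one_iff.1 hi, h]
      · exact (min_le_right _ _).trans h'
    choose b hb using hb
    have hF := h2 0 (fun _ => 0) M
    obtain ⟨c, hc⟩ := (hF.image b).bddBelow
    refine ⟨_, hF, c, fun γ hγ hM => ?_⟩
    have hmem : ofLex γ 0 ∈ {r : ℝ | r ≤ M ∧ ∃ γ ∈ f.support,
        (∀ i < 0, ofLex γ i = (fun _ => (0 : ℝ)) i) ∧ ofLex γ 0 = r} :=
      ⟨hM, γ, hγ, by simp, rfl⟩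
    exact ⟨hmem, (hc ⟨_, hmem, rfl⟩).trans (hb _ γ hγ rfl)⟩
  · rintro ⟨h1, h2⟩
    exact ⟨⟨h1.depth, h1.lowerFinite⟩, fun γ hγ => ⟨h2 γ hγ, h1.int γ hγ⟩⟩

/-! ### Substitution of `x (1 + z)` into monomials -/

section Mon

variable {R R' : Type*} [CommRing R] [CommRing R'] [Algebra ℝ R] [Algebra ℚ R]
  [Algebra ℝ R'] [Algebra ℚ R']

/-- The relative remainders of the iterated logarithms: `ℓ_k ∘ (x (1 + z)) = ℓ_k (1 + eps z k)`,
that is `1 + eps z (k + 1) = (1 - ℓ_{k+1} log (1 + eps z k))⁻¹`. -/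
noncomputable def eps (z : HahnSeries Exponent R) : ℕ → HahnSeries Exponent R
  | 0 => z
  | k + 1 => pw (-(single (unitExp (k + 1)) 1 * lg (eps z k))) (-1) - 1

/-- The substitution of `x (1 + z)` into the monomial with exponent `γ`. -/
noncomputable def mon (z : HahnSeries Exponent R) (γ : Exponent) : HahnSeries Exponent R :=
  single γ 1 * (ofLex γ).prod fun k c => pw (eps z k) c

variable {z : HahnSeries Exponent R}

omit [Algebra ℝ R] [Algebra ℚ R] in
theorem orderTop_unitExp_mul_pos {k : ℕ} {y : HahnSeries Exponent R} (hy : 0 < y.orderTop) :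
    0 < (single (unitExp k) 1 * y).orderTop :=
  orderTop_pos_mul (orderTop_single_pos (unitExp_pos k) 1) (nonneg_of_orderTop_pos hy)

omit [Algebra ℚ R] in
theorem pw_neg_one_sub_one_pos {y : HahnSeries Exponent R} (hy : 0 < y.orderTop) :
    0 < (pw y (-1) - 1).orderTop := by
  rw [pw, ← map_one (PowerSeries.heval y), ← map_sub]
  exact orderTop_heval_pos hy (by simp)

theorem eps_pos (hz : 0 < z.orderTop) (k : ℕ) : 0 < (eps z k).orderTop := by
  induction k with
  | zero => exact hz
  | succ k ih =>
    rw [eps]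
    exact pw_neg_one_sub_one_pos (orderTop_pos_neg (orderTop_unitExp_mul_pos (orderTop_lg_pos ih)))

theorem one_add_eps_succ_mul (hz : 0 < z.orderTop) (k : ℕ) :
    (1 + eps z (k + 1)) * (1 - single (unitExp (k + 1)) 1 * lg (eps z k)) = 1 := by
  have h := pw_neg_one_mul (orderTop_pos_neg
    (orderTop_unitExp_mul_pos (k := k + 1) (orderTop_lg_pos (eps_pos hz k))))
  rw [eps]
  linear_combination h

omit [Algebra ℝ R] [Algebra ℚ R] in
theorem exists_one_add_mul {a b : HahnSeries Exponent R} (ha : 0 < a.orderTop)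
    (hb : 0 < b.orderTop) : ∃ η, 0 < η.orderTop ∧ (1 + a) * (1 + b) = 1 + η :=
  ⟨a + b + a * b, orderTop_pos_one_add_mul ha hb, by ring⟩

theorem eps_eq (hz : 0 < z.orderTop) (k : ℕ) :
    ∃ η, 0 < η.orderTop ∧ eps z k = single (sig k) 1 * z * (1 + η) := by
  induction k with
  | zero => exact ⟨0, by simp, by simp [eps]⟩
  | succ k ih =>
    obtain ⟨η, h1, h2⟩ := ih
    obtain ⟨η', h3, h4⟩ := lg_eq (eps_pos hz k)
    obtain ⟨η'', h5, h6⟩ := pw_eq (orderTop_pos_neg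
      (orderTop_unitExp_mul_pos (k := k + 1) (orderTop_lg_pos (eps_pos hz k)))) (-1)
    obtain ⟨θ, h7, h8⟩ := exists_one_add_mul h1 h3
    obtain ⟨θ', h9, h10⟩ := exists_one_add_mul h7 (orderTop_pos_neg h5)
    refine ⟨θ', h9, ?_⟩
    rw [eps, h6, h4, h2, ← h10, ← h8, sig_succ, ← one_mul (1 : R), ← single_mul_single, one_mul]
    simp only [map_neg, map_one]
    ring

theorem mon_zero (z : HahnSeries Exponent R) : mon z 0 = 1 := by
  rw [mon, show ofLex (0 : Exponent) = 0 from rfl, Finsupp.prod_zero_index, mul_one,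
    single_zero_one]

theorem mon_add (z : HahnSeries Exponent R) (γ γ' : Exponent) :
    mon z (γ + γ') = mon z γ * mon z γ' := by
  rw [mon, mon, mon, show ofLex (γ + γ') = ofLex γ + ofLex γ' from rfl,
    Finsupp.prod_add_index' (fun k => pw_zero _) (fun k c d => pw_add _ c d),
    ← one_mul (1 : R), ← single_mul_single, one_mul]
  ring

/-- The submonoid generated by the support of `z` and the exponents of `ℓ₁, …, ℓ_N`. -/
noncomputable def genSubmonoid (z : HahnSeries Exponent R) (N : ℕ) : AddSubmonoid Exponent :=
  AddSubmonoid.closure (z.support ∪ (fun k => unitExp (k + 1)) '' Set.Iio N)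

omit [Algebra ℝ R] [Algebra ℚ R] in
theorem gen_nonneg (hz : 0 < z.orderTop) (N : ℕ) :
    ∀ γ ∈ z.support ∪ (fun k => unitExp (k + 1)) '' Set.Iio N, 0 ≤ γ := by
  rintro γ (h | ⟨k, -, rfl⟩)
  · exact nonneg_of_orderTop_pos hz γ h
  · exact (unitExp_pos _).le

omit [Algebra ℝ R] [Algebra ℚ R] in
theorem isPWO_genSubmonoid (hz : 0 < z.orderTop) (N : ℕ) :
    (genSubmonoid z N : Set Exponent).IsPWO := by
  refine Set.IsPWO.addSubmonoid_closure (gen_nonneg hz N) ?_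
  exact z.isPWO_support.union ((Set.finite_Iio N).image _).isPWO

omit [Algebra ℝ R] [Algebra ℚ R] in
theorem genSubmonoid_nonneg (hz : 0 < z.orderTop) (N : ℕ) :
    ∀ γ ∈ genSubmonoid z N, 0 ≤ γ := fun γ hγ => by
  have h : genSubmonoid z N ≤ nonnegSubmonoid Exponent :=
    AddSubmonoid.closure_le.2 (gen_nonneg hz N)
  exact h hγ

omit [Algebra ℝ R] [Algebra ℚ R] in
theorem support_subset_gen (z : HahnSeries Exponent R) (N : ℕ) :
    z.support ⊆ genSubmonoid z N :=
  Set.subset_union_left.trans AddSubmonoid.subset_closure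

omit [Algebra ℝ R] [Algebra ℚ R] in
theorem unitExp_mem_gen (z : HahnSeries Exponent R) {k N : ℕ} (h : k < N) :
    unitExp (k + 1) ∈ genSubmonoid z N :=
  AddSubmonoid.subset_closure (Or.inr ⟨k, h, rfl⟩)

omit [Algebra ℝ R] [Algebra ℚ R] in
theorem genSubmonoid_le {N : ℕ} {L : AddSubmonoid Exponent} (h : z.support ⊆ L)
    (h' : ∀ k < N, unitExp (k + 1) ∈ L) : genSubmonoid z N ≤ L := by
  refine AddSubmonoid.closure_le.2 ?_
  rintro γ (h1 | ⟨k, hk, rfl⟩)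
  exacts [h h1, h' k hk]

omit [Algebra ℝ R] [Algebra ℚ R] in
theorem genSubmonoid_le_depth {N : ℕ} (h : z.support ⊆ depth N) :
    genSubmonoid z N ≤ (depth N).toAddSubmonoid :=
  genSubmonoid_le h fun _ hk => unitExp_mem_depth hk

omit [Algebra ℝ R] [Algebra ℚ R] in
theorem good_genSubmonoid (hz : 0 < z.orderTop) (h : Good z.support) :
    Good (genSubmonoid z 1 : Set Exponent) := by
  refine Good.closure (h.union ?_) (gen_nonneg hz 1)
  refine (good_singleton (γ := unitExp 1) (unitExp_mem_depth le_rfl)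
    ⟨1, by simp [unitExp_apply]⟩).mono ?_
  rintro _ ⟨k, hk, rfl⟩
  rw [Set.mem_Iio, Nat.lt_one_iff] at hk
  subst hk
  rfl

omit [Algebra ℝ R] [Algebra ℚ R] in
theorem support_single_subset_of_mem {L : AddSubmonoid Exponent} {γ : Exponent} (h : γ ∈ L)
    (r : R) : (single γ r).support ⊆ L := fun β hβ => by
  rw [eq_of_mem_support_single hβ]
  exact h

omit [Algebra ℝ R] [Algebra ℚ R] in
theorem support_neg_subset_of_mem {L : AddSubmonoid Exponent} {y : HahnSeries Exponent R}
    (h : y.support ⊆ L) : (-y).support ⊆ L := by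
  rwa [support_neg]

omit [Algebra ℝ R] [Algebra ℚ R] in
theorem support_sub_subset_of_mem {L : AddSubmonoid Exponent} {x y : HahnSeries Exponent R}
    (hx : x.support ⊆ L) (hy : y.support ⊆ L) : (x - y).support ⊆ L :=
  (support_sub_subset x y).trans (Set.union_subset hx hy)

omit [Algebra ℝ R] [Algebra ℚ R] in
theorem support_add_subset_of_mem {L : AddSubmonoid Exponent} {x y : HahnSeries Exponent R}
    (hx : x.support ⊆ L) (hy : y.support ⊆ L) : (x + y).support ⊆ L :=
  (support_add_subset x y).trans (Set.union_subset hx hy)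

theorem support_eps (z : HahnSeries Exponent R) {k N : ℕ} (hk : k ≤ N) :
    (eps z k).support ⊆ genSubmonoid z N := by
  induction k with
  | zero => exact support_subset_gen z N
  | succ k ih =>
    rw [eps]
    refine support_sub_subset_of_mem (support_heval_subset (support_neg_subset_of_mem
      (support_mul_subset_of_mem (support_single_subset_of_mem (unitExp_mem_gen z hk) 1)
      (support_heval_subset (ih (by omega)) _))) _) (support_one_subset _)

theorem support_prod_pw (z : HahnSeries Exponent R) {N : ℕ} {γ : Exponent} (hγ : γ ∈ depth N) :
    ((ofLex γ).prod fun k c => pw (eps z k) c).support ⊆ genSubmonoid z N := by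
  rw [Finsupp.prod]
  refine Finset.prod_induction _ (fun y : HahnSeries Exponent R => y.support ⊆ genSubmonoid z N)
    (fun _ _ => support_mul_subset_of_mem) (support_one_subset _) ?_
  intro k hk
  refine support_heval_subset (support_eps z ?_) _
  by_contra h
  exact Finsupp.mem_support_iff.1 hk (hγ k (by omega))

omit [Algebra ℝ R] [Algebra ℚ R] in
theorem sub_mem_of_mem_support_single_mul {γ β : Exponent} {y : HahnSeries Exponent R}
    (h : β ∈ (single γ 1 * y).support) : β - γ ∈ y.support := by
  rwa [mem_support, coeff_single_mul, one_mul] at h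

theorem shiftBounded_mon (hz : 0 < z.orderTop) (N : ℕ) :
    ShiftBounded (genSubmonoid z N) (depth N).toAddSubmonoid (mon z) :=
  ⟨isPWO_genSubmonoid hz N, fun _ hγ _ hβ =>
    support_prod_pw z hγ (sub_mem_of_mem_support_single_mul hβ)⟩

theorem mapHom_eps (φ : R →ₐ[ℝ] R') (hz : 0 < z.orderTop) (k : ℕ) :
    mapHom (φ : R →+* R') (eps z k) = eps (mapHom (φ : R →+* R') z) k := by
  induction k with
  | zero => rfl
  | succ k ih =>
    rw [eps, map_sub, map_one (mapHom _), mapHom_pw φ (orderTop_pos_neg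
      (orderTop_unitExp_mul_pos (orderTop_lg_pos (eps_pos hz k)))), map_neg, map_mul, mapHom_single,
      mapHom_lg _ (eps_pos hz k), ih, map_one (φ : R →+* R'), eps]

theorem mapHom_mon (φ : R →ₐ[ℝ] R') (hz : 0 < z.orderTop) (γ : Exponent) :
    mapHom (φ : R →+* R') (mon z γ) = mon (mapHom (φ : R →+* R') z) γ := by
  rw [mon, map_mul, mapHom_single, map_one, Finsupp.prod, map_prod, mon, Finsupp.prod]
  congr 1
  refine Finset.prod_congr rfl fun k _ => ?_
  rw [mapHom_pw φ (eps_pos hz k), mapHom_eps φ hz]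

/-- The substitution changes a monomial only by `γ_k z ℓ₁ ⋯ ℓ_k` times the monomial, up to higher
order terms, where `k` is the first index with `γ_k ≠ 0`. -/
theorem mon_eq (hz : 0 < z.orderTop) {γ : Exponent} {k : ℕ} (hk : IsLead γ k) :
    ∃ η, 0 < η.orderTop ∧ mon z γ =
      single γ 1 + single (γ + sig k) 1 * z * (C (algebraMap ℝ R (ofLex γ k)) + η) := by
  have key : ∀ j c, k < j → ∃ η, 0 < η.orderTop ∧
      pw (eps z j) c = 1 + single (sig k) 1 * z * η := by
    intro j c hj
    obtain ⟨η, h1, h2⟩ := pw_eq (eps_pos hz j) c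
    obtain ⟨θ, h3, h4⟩ := eps_eq hz j
    refine ⟨single (sig j - sig k) 1 * ((1 + θ) * (C (algebraMap ℝ R c) + η)),
      orderTop_pos_mul (orderTop_single_pos (sub_pos.2 (sig_strictMono hj)) 1) ?_, ?_⟩
    · intro γ hγ
      refine support_mul_subset_of_mem (L := nonnegSubmonoid Exponent) ?_ ?_ hγ
      · exact support_add_subset_of_mem (support_one_subset _) (nonneg_of_orderTop_pos h3)
      · exact support_add_subset_of_mem
          (support_single_subset_of_mem (nonnegSubmonoid Exponent).zero_mem _)
          (nonneg_of_orderTop_pos h1)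
    · have : (single (sig j) (1 : R)) = single (sig k) 1 * single (sig j - sig k) 1 := by
        rw [single_mul_single, add_sub_cancel, one_mul]
      rw [h2, h4, this]
      ring
  have key2 : ∀ s : Finset ℕ, (∀ j ∈ s, k < j) → ∃ η, 0 < η.orderTop ∧
      ∏ j ∈ s, pw (eps z j) (ofLex γ j) = 1 + single (sig k) 1 * z * η := by
    intro s hs
    induction s using Finset.induction_on with
    | empty => exact ⟨0, by simp, by simp⟩
    | insert j s hj ih =>
      obtain ⟨η, h1, h2⟩ := ih fun i hi => hs i (Finset.mem_insert_of_mem hi)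
      obtain ⟨η', h3, h4⟩ := key j (ofLex γ j) (hs j (Finset.mem_insert_self _ _))
      have hsig : ∀ γ ∈ (single (sig k) (1 : R) * z).support, 0 ≤ γ := by
        intro γ hγ
        refine support_mul_subset_of_mem (L := nonnegSubmonoid Exponent)
          (support_single_subset_of_mem ?_ _) (nonneg_of_orderTop_pos hz) hγ
        have := sig_strictMono.monotone (Nat.zero_le k)
        rwa [sig_zero] at this
      refine ⟨η + η' + η * (single (sig k) 1 * z * η'), orderTop_pos_add (orderTop_pos_add h1 h3)
        (orderTop_pos_mul h1 fun γ hγ => support_mul_subset_of_mem (L := nonnegSubmonoid Exponent)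
          hsig (nonneg_of_orderTop_pos h3) hγ), ?_⟩
      rw [Finset.prod_insert hj, h2, h4]
      ring
  obtain ⟨η, h1, h2⟩ := key2 ((ofLex γ).support.erase k) fun j hj => by
    rw [Finset.mem_erase, Finsupp.mem_support_iff] at hj
    rcases lt_trichotomy j k with h | h | h
    · exact absurd (hk.2 j h) hj.2
    · exact absurd h hj.1
    · exact h
  obtain ⟨η', h3, h4⟩ := pw_eq (eps_pos hz k) (ofLex γ k)
  obtain ⟨θ, h5, h6⟩ := eps_eq hz k
  have hprod : ((ofLex γ).prod fun k c => pw (eps z k) c) =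
      (1 + single (sig k) 1 * z * ((1 + θ) * (C (algebraMap ℝ R (ofLex γ k)) + η'))) *
        (1 + single (sig k) 1 * z * η) := by
    rw [Finsupp.prod, ← Finset.mul_prod_erase _ _ (Finsupp.mem_support_iff.2 hk.1), h2, h4, h6]
    ring
  have hC : ∀ γ' ∈ (C (algebraMap ℝ R (ofLex γ k)) : HahnSeries Exponent R).support, 0 ≤ γ' :=
    fun γ' h => (eq_of_mem_support_single h).ge
  have h7 : ∀ γ' ∈ ((1 + θ) * (C (algebraMap ℝ R (ofLex γ k)) + η')).support, 0 ≤ γ' := by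
    intro γ' hγ
    refine support_mul_subset_of_mem (L := nonnegSubmonoid Exponent) ?_ ?_ hγ
    · exact support_add_subset_of_mem (support_one_subset _) (nonneg_of_orderTop_pos h5)
    · exact support_add_subset_of_mem hC (nonneg_of_orderTop_pos h3)
  have h8 : ∀ γ ∈ (single (sig k) (1 : R) * z).support, 0 ≤ γ := by
    intro γ hγ
    refine support_mul_subset_of_mem (L := nonnegSubmonoid Exponent)
      (support_single_subset_of_mem ?_ _) (nonneg_of_orderTop_pos hz) hγ
    have := sig_strictMono.monotone (Nat.zero_le k)
    rwa [sig_zero] at this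
  refine ⟨η' + θ * (C (algebraMap ℝ R (ofLex γ k)) + η') + η +
    η * (single (sig k) 1 * z * ((1 + θ) * (C (algebraMap ℝ R (ofLex γ k)) + η'))), ?_, ?_⟩
  · refine orderTop_pos_add (orderTop_pos_add (orderTop_pos_add h3 (orderTop_pos_mul h5 ?_)) h1)
      (orderTop_pos_mul h1 ?_)
    · exact support_add_subset_of_mem (L := nonnegSubmonoid Exponent) hC (nonneg_of_orderTop_pos h3)
    · exact support_mul_subset_of_mem (L := nonnegSubmonoid Exponent) h8 h7
  · have : (single (γ + sig k) (1 : R)) = single γ 1 * single (sig k) 1 := by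
      rw [single_mul_single, one_mul]
    rw [mon, hprod, this]
    ring

end Mon

/-! ### Comparison with the formal composition -/

section Composition

theorem order_single_mul_one_add {γ : Exponent} {a : ℝ} (ha : a ≠ 0) {p : Transseries}
    (hp : 0 < p.orderTop) :
    (single γ a * (1 + p)).order = γ ∧ (single γ a * (1 + p)).leadingCoeff = a := by
  have h1 : (1 + p).orderTop = 0 ∧ (1 + p).leadingCoeff = 1 :=
    (orderTop_self_sub_one_pos_iff (1 + p)).1 (by simpa using hp)
  have h0 : (1 + p) ≠ 0 := by
    rw [← leadingCoeff_ne_zero, h1.2]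
    exact one_ne_zero
  have h2 : (1 + p).order = 0 := by
    have := order_eq_orderTop_of_ne_zero h0
    rw [h1.1] at this
    exact_mod_cast this
  refine ⟨?_, ?_⟩
  · rw [order_mul (single_ne_zero ha) h0, order_single ha, h2, add_zero]
  · rw [leadingCoeff_mul, leadingCoeff_of_single, h1.2, mul_one]

theorem remainder_single_mul {γ : Exponent} {a : ℝ} (ha : a ≠ 0) {p : Transseries}
    (hp : 0 < p.orderTop) : remainder (single γ a * (1 + p)) = p := by
  obtain ⟨h1, h2⟩ := order_single_mul_one_add (γ := γ) ha hp
  rw [remainder, h1, h2, mul_right_comm, single_mul_single, add_neg_cancel, mul_inv_cancel₀ ha,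
    single_zero_one]
  ring

theorem eq_single_mul_remainder {h : Transseries} (h0 : h ≠ 0) :
    h = single h.order h.leadingCoeff * (1 + remainder h) := by
  have hc : h.leadingCoeff ≠ 0 := leadingCoeff_ne_zero.2 h0
  rw [remainder, add_sub_cancel, mul_left_comm, single_mul_single, add_neg_cancel,
    mul_inv_cancel₀ hc, single_zero_one, mul_one]

theorem orderTop_remainder_pos {h : Transseries} (h0 : h ≠ 0) : 0 < (remainder h).orderTop := by
  have hc : h.leadingCoeff ≠ 0 := leadingCoeff_ne_zero.2 h0
  have h1 := unit_aux h (inv_mul_cancel₀ hc) _ (neg_add_cancel h.order)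
  rw [remainder, mul_comm, ← orderTop_neg, neg_sub]
  exact h1

theorem rpow_single_mul {γ : Exponent} {a : ℝ} (ha : a ≠ 0) {p : Transseries}
    (hp : 0 < p.orderTop) (c : ℝ) :
    rpow (single γ a * (1 + p)) c = single (c • γ) (a ^ c) * pw p c := by
  obtain ⟨h1, h2⟩ := order_single_mul_one_add (γ := γ) ha hp
  rw [rpow, remainder_single_mul ha hp, h1, h2, pw]

theorem negLog_single_mul (k : ℕ) {p : Transseries} (hp : 0 < p.orderTop) :
    negLog (single (unitExp k) 1 * (1 + p)) = single (-unitExp (k + 1)) 1 - lg p := by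
  obtain ⟨h1, h2⟩ := order_single_mul_one_add (γ := unitExp k) one_ne_zero hp
  rw [negLog, remainder_single_mul one_ne_zero hp, h1, h2, lg]
  simp [unitExp, const]

variable {z : Transseries}

theorem ellComp_eq (hz : 0 < z.orderTop) (k : ℕ) :
    ellComp (X * (1 + z)) k = single (unitExp k) 1 * (1 + eps z k) := by
  induction k with
  | zero => rfl
  | succ k ih =>
    rw [ellComp, ih, negLog_single_mul k (eps_pos hz k)]
    refine inv_eq_of_mul_eq_one_right ?_
    have h := one_add_eps_succ_mul hz k
    have h2 : (single (-unitExp (k + 1)) (1 : ℝ)) * single (unitExp (k + 1)) 1 = 1 := by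
      rw [single_mul_single, neg_add_cancel, one_mul, single_zero_one]
    linear_combination h + (1 + eps z (k + 1)) * h2

theorem prod_single_smul_unitExp (γ : Exponent) :
    ((ofLex γ).prod fun k c => single (c • unitExp k) (1 : ℝ)) = single γ 1 := by
  have h : ∀ g : ℕ →₀ ℝ, (g.prod fun k c => single (c • unitExp k) (1 : ℝ)) =
      single (toLex g) 1 := by
    intro g
    induction g using Finsupp.induction_linear with
    | zero => rw [Finsupp.prod_zero_index]; rfl
    | add f g hf hg =>
      rw [Finsupp.prod_add_index', hf, hg, single_mul_single, one_mul]
      · rfl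
      · intro k; rw [zero_smul, single_zero_one]
      · intro k c d
        rw [single_mul_single, one_mul]
        congr 2
        exact exponent_ext fun j => add_mul c d _
    | single k c =>
      rw [Finsupp.prod_single_index]
      · congr 2
        refine exponent_ext fun j => ?_
        change c * ofLex (unitExp k) j = (Finsupp.single k c) j
        simp [unitExp_apply, Finsupp.single_apply]
      · rw [zero_smul, single_zero_one]
  exact h (ofLex γ)

theorem monoComp_eq (hz : 0 < z.orderTop) (γ : Exponent) :
    monoComp γ (X * (1 + z)) = mon z γ := by
  rw [monoComp, mon, ← prod_single_smul_unitExp γ, ← Finsupp.prod_mul]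
  refine Finsupp.prod_congr fun k _ => ?_
  rw [ellComp_eq hz, rpow_single_mul one_ne_zero (eps_pos hz k), Real.one_rpow]

/-- For the inner series `x (1 + z)`, formal composition is the operator `lin (mon z)`. -/
theorem isComp_iff (hz : 0 < z.orderTop) {N : ℕ} {g r : Transseries} (hg : g.support ⊆ depth N) :
    IsComp g (X * (1 + z)) r ↔ r = lin (mon z) g := by
  obtain ⟨h1, h2⟩ := order_single_mul_one_add (γ := unitExp 0) one_ne_zero hz
  constructor
  · rintro ⟨-, -, s, hs, rfl⟩
    exact hsum_eq_lin s fun γ => by rw [hs, monoComp_eq hz]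
  · rintro rfl
    refine ⟨h2 ▸ one_pos, h1 ▸ unitExp_pos 0, ?_⟩
    obtain ⟨s, hs, hs'⟩ := exists_family_lin (shiftBounded_mon hz N) hg
    exact ⟨s, fun γ => by rw [hs, monoComp_eq hz], hs'⟩

end Composition

/-! ### Associativity of the composition -/

section Assoc

variable {z w : Transseries} {N : ℕ}

theorem mon_unitExp (hw : 0 < w.orderTop) (k : ℕ) :
    mon w (unitExp k) = single (unitExp k) 1 * (1 + eps w k) := by
  rw [mon, show ofLex (unitExp k) = Finsupp.single k 1 from rfl,
    Finsupp.prod_single_index (pw_zero _), pw_one (eps_pos hw k)]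

theorem orderTop_lin_mon_pos (hw : 0 < w.orderTop) {g : Transseries} (hg : g.support ⊆ depth N)
    (hg0 : 0 < g.orderTop) : 0 < (lin (mon w) g).orderTop := by
  rw [orderTop_pos_iff] at hg0 ⊢
  intro β hβ
  obtain ⟨γ, h1, h2⟩ := support_lin (shiftBounded_mon hw N) hg hβ
  have := add_pos_of_pos_of_nonneg (hg0 γ h1) (genSubmonoid_nonneg hw N _ h2)
  simpa using this

theorem support_lin_mon (hw : 0 < w.orderTop) (hwN : w.support ⊆ depth N) {g : Transseries}
    (hg : g.support ⊆ depth N) : (lin (mon w) g).support ⊆ depth N := by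
  intro β hβ
  obtain ⟨γ, h1, h2⟩ := support_lin (shiftBounded_mon hw N) hg hβ
  have := add_mem (hg h1) (genSubmonoid_le_depth hwN h2)
  simpa using this

theorem support_mon (hz : z.support ⊆ depth N) {γ : Exponent} (hγ : γ ∈ depth N) :
    (mon z γ).support ⊆ depth N := by
  intro β hβ
  have h := genSubmonoid_le_depth hz (support_prod_pw z hγ (sub_mem_of_mem_support_single_mul hβ))
  have := add_mem hγ h
  simpa using this

theorem lin_mon_mul (hw : 0 < w.orderTop) {g g' : Transseries} (hg : g.support ⊆ depth N)
    (hg' : g'.support ⊆ depth N) :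
    lin (mon w) (g * g') = lin (mon w) g * lin (mon w) g' :=
  lin_mul (shiftBounded_mon hw N) (fun γ _ γ' _ => mon_add w γ γ') hg hg'

theorem lin_mon_heval (hw : 0 < w.orderTop) {g : Transseries} (hg : g.support ⊆ depth N)
    (hg0 : 0 < g.orderTop) (P : PowerSeries ℝ) :
    lin (mon w) (PowerSeries.heval g P) = PowerSeries.heval (lin (mon w) g) P :=
  lin_heval (shiftBounded_mon hw N) (mon_zero w) (fun γ _ γ' _ => mon_add w γ γ') hg hg0
    (orderTop_lin_mon_pos hw hg hg0) P

theorem lin_mon_one (w : Transseries) : lin (mon w) 1 = 1 := by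
  have := lin_single (m := mon w) 0 (1 : ℝ)
  rwa [mon_zero, one_smul, single_zero_one] at this

/-- `x (1 + star w z)` is the composition of `x (1 + z)` with `x (1 + w)`. -/
noncomputable def star (w z : Transseries) : Transseries :=
  w + lin (mon w) z + w * lin (mon w) z

theorem star_pos (hw : 0 < w.orderTop) (hz : 0 < z.orderTop) (hzN : z.support ⊆ depth N) :
    0 < (star w z).orderTop :=
  orderTop_pos_one_add_mul hw (orderTop_lin_mon_pos hw hzN hz)

theorem X_support_subset (N : ℕ) : X.support ⊆ depth N :=
  support_single_subset_of_mem (L := (depth N).toAddSubmonoid) (unitExp_mem_depth (Nat.zero_le N)) 1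

theorem one_add_support_subset {y : Transseries} (hy : y.support ⊆ depth N) :
    (1 + y).support ⊆ depth N :=
  support_add_subset_of_mem (L := (depth N).toAddSubmonoid) (support_one_subset _) hy

theorem X_mul_star (hw : 0 < w.orderTop) (hzN : z.support ⊆ depth N) :
    lin (mon w) (X * (1 + z)) = X * (1 + star w z) := by
  rw [lin_mon_mul hw (X_support_subset N) (one_add_support_subset hzN), X, lin_single, one_smul,
    mon_unitExp hw, lin_add (shiftBounded_mon hw N)
      (support_one_subset (depth N).toAddSubmonoid) hzN, lin_mon_one, star, eps]
  ring

theorem support_eps_depth (hz : z.support ⊆ depth N) {k : ℕ} (hk : k ≤ N) :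
    (eps z k).support ⊆ depth N :=
  (support_eps z hk).trans (genSubmonoid_le_depth hz)

/-- The chain rule `ℓ_k ∘ (h ∘ g) = (ℓ_k ∘ h) ∘ g` in terms of relative remainders. It rests on
`log ((1 + a) (1 + b)) = log (1 + a) + log (1 + b)`. -/
theorem eps_star (hw : 0 < w.orderTop) (hz : 0 < z.orderTop) (hzN : z.support ⊆ depth N) {k : ℕ}
    (hk : k ≤ N) :
    eps (star w z) k =
      eps w k + lin (mon w) (eps z k) + eps w k * lin (mon w) (eps z k) := by
  induction k with
  | zero => rfl
  | succ k ih =>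
    have ih := ih (by omega)
    have hek := support_eps_depth hzN (Nat.le_of_succ_le hk)
    have h1 := one_add_eps_succ_mul (star_pos hw hz hzN) k
    have h2 := one_add_eps_succ_mul hw k
    have h3 := congrArg (lin (mon w)) (one_add_eps_succ_mul hz k)
    have hlgN : (lg (eps z k)).support ⊆ depth N :=
      support_heval_subset (L := (depth N).toAddSubmonoid) hek _
    have hl : lin (mon w) (lg (eps z k)) = lg (lin (mon w) (eps z k)) :=
      lin_mon_heval hw hek (eps_pos hz k) _
    have hsN : (single (unitExp (k + 1)) (1 : ℝ)).support ⊆ depth N :=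
      support_single_subset_of_mem (L := (depth N).toAddSubmonoid) (unitExp_mem_depth hk) 1
    have h1N : (1 : Transseries).support ⊆ depth N := support_one_subset (depth N).toAddSubmonoid
    have hmN : (single (unitExp (k + 1)) (1 : ℝ) * lg (eps z k)).support ⊆ depth N :=
      support_mul_subset_of_mem (L := (depth N).toAddSubmonoid) hsN hlgN
    rw [lin_mon_mul hw (one_add_support_subset (support_eps_depth hzN hk))
      (support_sub_subset_of_mem (L := (depth N).toAddSubmonoid) h1N hmN),
      lin_add (shiftBounded_mon hw N) h1N (support_eps_depth hzN hk),
      lin_sub (shiftBounded_mon hw N) h1N hmN, lin_mon_mul hw hsN hlgN, lin_mon_one, hl,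
      lin_single, one_smul, mon_unitExp hw] at h3
    rw [ih, lg_mul (eps_pos hw k) (orderTop_lin_mon_pos hw hek (eps_pos hz k))] at h1
    set A := eps w (k + 1)
    set B := lin (mon w) (eps z (k + 1))
    set U := eps (star w z) (k + 1)
    set l := single (unitExp (k + 1)) (1 : ℝ)
    set La := lg (eps w k)
    set Lb := lg (lin (mon w) (eps z k))
    have h4 : (1 + A) * (1 + B) * (1 - l * (La + Lb)) = 1 := by
      linear_combination (1 + B) * h2 + h3
    linear_combination (1 + A) * (1 + B) * h1 - (1 + U) * h4

theorem lin_mon_prod {ι : Type*} (hw : 0 < w.orderTop) (s : Finset ι) (y : ι → Transseries)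
    (hy : ∀ i ∈ s, (y i).support ⊆ depth N) :
    (∏ i ∈ s, y i).support ⊆ depth N ∧
      lin (mon w) (∏ i ∈ s, y i) = ∏ i ∈ s, lin (mon w) (y i) := by
  classical
  induction s using Finset.induction_on with
  | empty => exact ⟨support_one_subset (depth N).toAddSubmonoid, by simpa using lin_mon_one w⟩
  | insert i s hi ih =>
    obtain ⟨h1, h2⟩ := ih fun j hj => hy j (Finset.mem_insert_of_mem hj)
    have h3 := hy i (Finset.mem_insert_self _ _)
    rw [Finset.prod_insert hi, Finset.prod_insert hi]
    exact ⟨support_mul_subset_of_mem (L := (depth N).toAddSubmonoid) h3 h1,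
      by rw [lin_mon_mul hw h3 h1, h2]⟩

theorem lin_mon_mon (hw : 0 < w.orderTop) (hz : 0 < z.orderTop) (hzN : z.support ⊆ depth N)
    {γ : Exponent} (hγ : γ ∈ depth N) : lin (mon w) (mon z γ) = mon (star w z) γ := by
  have hk : ∀ k ∈ (ofLex γ).support, k ≤ N := fun k hk => by
    by_contra h
    exact Finsupp.mem_support_iff.1 hk (hγ k (by omega))
  have hsup : ∀ k ∈ (ofLex γ).support, (pw (eps z k) (ofLex γ k)).support ⊆ depth N :=
    fun k h => support_heval_subset (L := (depth N).toAddSubmonoid)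
      (support_eps_depth hzN (hk k h)) _
  obtain ⟨h1, h2⟩ := lin_mon_prod hw _ _ hsup
  rw [mon, Finsupp.prod, lin_mon_mul hw (support_single_subset_of_mem
    (L := (depth N).toAddSubmonoid) hγ 1) h1, h2, lin_single, one_smul, mon, mon, Finsupp.prod,
    Finsupp.prod, mul_assoc, ← Finset.prod_mul_distrib]
  congr 1
  refine Finset.prod_congr rfl fun k h => ?_
  have hek := support_eps_depth hzN (hk k h)
  rw [eps_star hw hz hzN (hk k h), pw_mul (eps_pos hw k)
    (orderTop_lin_mon_pos hw hek (eps_pos hz k))]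
  congr 1
  exact lin_mon_heval hw hek (eps_pos hz k) _

/-- `(g ∘ h) ∘ h' = g ∘ (h ∘ h')`. -/
theorem lin_mon_lin_mon (hw : 0 < w.orderTop) (hz : 0 < z.orderTop) (hzN : z.support ⊆ depth N)
    {g : Transseries} (hg : g.support ⊆ depth N) :
    lin (mon w) (lin (mon z) g) = lin (mon (star w z)) g := by
  obtain ⟨s, hs, hs'⟩ := exists_family_lin (shiftBounded_mon hz N) hg
  have hsN : ∀ γ, (s γ).support ⊆ depth N := by
    intro γ
    by_cases hγ : γ ∈ g.support
    · rw [hs]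
      exact (support_smul_subset _ _).trans (support_mon hzN (hg hγ))
    · rw [hs, show g.coeff γ = 0 by simpa using hγ]
      simp
  obtain ⟨t, ht, ht'⟩ := lin_hsum (shiftBounded_mon hw N) s hsN
  rw [← hs', ht']
  refine hsum_eq_lin t fun γ => ?_
  by_cases hγ : γ ∈ g.support
  · rw [ht, hs, lin_smul (shiftBounded_mon hw N) (support_mon hzN (hg hγ)),
      lin_mon_mon hw hz hzN (hg hγ)]
  · rw [ht, hs, show g.coeff γ = 0 by simpa using hγ, zero_smul, zero_smul]
    ext; simp [lin]

end Assoc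

/-! ### Transseries invariant under substitution are constant -/

section Invariant

variable {z : Transseries}

theorem coeff_single_mul_mul_of_le {γ : Exponent} (hz0 : z ≠ 0) {y : Transseries}
    (hy : ∀ γ ∈ y.support, 0 ≤ γ) :
    (∀ β < γ + z.order, (single γ 1 * z * y).coeff β = 0) ∧
      (single γ 1 * z * y).coeff (γ + z.order) = z.leadingCoeff * y.coeff 0 := by
  have hs : (single γ (1 : ℝ)) ≠ 0 := single_ne_zero one_ne_zero
  have ho : (single γ 1 * z).order = γ + z.order := by
    rw [order_mul hs hz0, order_single one_ne_zero]
  have hl : (single γ 1 * z).leadingCoeff = z.leadingCoeff := by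
    rw [leadingCoeff_mul, leadingCoeff_of_single, one_mul]
  constructor
  · intro β hβ
    by_contra h
    obtain ⟨a, ha, b, hb, hab⟩ := support_mul_subset h
    have h1 := order_le_of_coeff_ne_zero ha
    rw [ho] at h1
    have h2 := add_le_add h1 (hy b hb)
    rw [add_zero] at h2
    exact absurd (h2.trans_eq hab) (not_le.2 hβ)
  · by_cases h0 : y.coeff 0 = 0
    · rw [h0, mul_zero]
      by_contra h
      obtain ⟨a, ha, b, hb, hab⟩ := support_mul_subset h
      have h1 := order_le_of_coeff_ne_zero ha
      rw [ho] at h1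
      have hb0 : 0 < b := lt_of_le_of_ne (hy b hb) (by rintro rfl; exact hb h0)
      have h2 := add_lt_add_of_le_of_lt h1 hb0
      rw [add_zero] at h2
      exact absurd hab h2.ne'
    · have hy0 : y ≠ 0 := ne_zero_of_coeff_ne_zero h0
      have hyo : y.order = 0 :=
        le_antisymm (order_le_of_coeff_ne_zero h0)
          (hy _ (by rw [mem_support]; exact fun h => hy0 (coeff_order_eq_zero.1 h)))
      have := coeff_mul_order_add_order (single γ 1 * z) y
      rwa [ho, hl, hyo, add_zero, leadingCoeff_eq (x := y), hyo] at this

/-- The difference `m_γ ∘ h - m_γ` for a monomial `m_γ` and `h = x (1 + z)` has leading exponent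
`γ + sig k + ord z`, where `k` is the first index with `γ_k ≠ 0`. -/
theorem coeff_mon (hz : 0 < z.orderTop) (hz0 : z ≠ 0) {γ : Exponent} {k : ℕ} (hk : IsLead γ k) :
    (∀ β < γ + sig k + z.order, (mon z γ).coeff β = (single γ (1 : ℝ)).coeff β) ∧
      (mon z γ).coeff (γ + sig k + z.order) =
        (single γ (1 : ℝ)).coeff (γ + sig k + z.order) + z.leadingCoeff * ofLex γ k := by
  obtain ⟨η, h1, h2⟩ := mon_eq hz hk
  have hy : ∀ γ' ∈ (C (algebraMap ℝ ℝ (ofLex γ k)) + η).support, 0 ≤ γ' :=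
    support_add_subset_of_mem (L := nonnegSubmonoid Exponent)
      (support_single_subset_of_mem (nonnegSubmonoid Exponent).zero_mem _)
      (nonneg_of_orderTop_pos h1)
  obtain ⟨h3, h4⟩ := coeff_single_mul_mul_of_le (γ := γ + sig k) hz0 hy
  constructor
  · intro β hβ
    rw [h2, coeff_add, h3 β hβ, add_zero]
  · rw [h2, coeff_add, h4, coeff_add, coeff_eq_zero_of_lt_orderTop (x := η) (by exact_mod_cast h1)]
    simp [C_apply]

/-- Let `γ ≠ 0` be the least nonzero exponent of `g`. By `add_sig_lt` and `coeff_mon` the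
coefficient of `g ∘ h - g` at `γ + sig k + ord z` comes from the monomial `γ` alone,
and it is nonzero. -/
theorem eq_const_of_isComp_self (hz : 0 < z.orderTop) (hz0 : z ≠ 0) {g : Transseries}
    (hg : IsComp g (X * (1 + z)) g) : ∃ c : ℝ, g = const c := by
  obtain ⟨-, -, s, hs, hsum⟩ := hg
  simp only [monoComp_eq hz] at hs
  by_contra hne
  have hex : (g.support \ {0}).Nonempty := by
    by_contra he
    rw [Set.not_nonempty_iff_eq_empty, Set.sdiff_eq_empty] at he
    refine hne ⟨g.coeff 0, ?_⟩
    ext γ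
    by_cases hγ : γ = 0
    · subst hγ; simp [const, C_apply]
    · rw [const, C_apply, coeff_single_of_ne hγ]
      by_contra h
      exact hγ (he h)
  have hwf : (g.support \ {0}).IsWF := g.isWF_support.mono Set.sdiff_subset
  set γ := hwf.min hex
  have hγ : γ ∈ g.support \ {0} := hwf.min_mem hex
  have hmin : ∀ γ' ∈ g.support, γ' ≠ 0 → γ ≤ γ' := fun γ' h h' => hwf.min_le hex ⟨h, h'⟩
  obtain ⟨k, hk⟩ := exists_isLead hγ.2
  obtain ⟨t, ht, ht'⟩ := exists_family_monomials g
  set β := γ + sig k + z.order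
  have h0 : (s - t).hsum.coeff β = 0 := by
    rw [SummableFamily.hsum_sub, hsum, ht', sub_self, coeff_zero]
  have hterm : ∀ γ', γ' ≠ γ → ((s - t) γ').coeff β = 0 := by
    intro γ' hne'
    rw [SummableFamily.sub_apply, hs, ht, coeff_sub, coeff_smul, smul_eq_mul]
    by_cases hγ' : γ' ∈ g.support
    · by_cases h0' : γ' = 0
      · subst h0'
        rw [mon_zero, ← single_zero_one, coeff_single, coeff_single]
        split_ifs <;> simp
      · obtain ⟨k', hk'⟩ := exists_isLead h0'
        have hlt := add_sig_lt (lt_of_le_of_ne (hmin γ' hγ' h0') hne'.symm) hk hk'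
        rw [(coeff_mon hz hz0 hk').1 β (add_lt_add_left hlt _), coeff_single, coeff_single]
        split_ifs <;> simp
    · rw [show g.coeff γ' = 0 by simpa using hγ']
      simp
  rw [SummableFamily.coeff_hsum, finsum_eq_single _ γ hterm, SummableFamily.sub_apply, hs, ht,
    coeff_sub, coeff_smul, smul_eq_mul, (coeff_mon hz hz0 hk).2] at h0
  have h1 : g.coeff γ * (z.leadingCoeff * ofLex γ k) = 0 := by
    rw [show γ + sig k + z.order = β from rfl, coeff_single, coeff_single] at h0
    split_ifs at h0 <;> linarith
  have h2 : g.coeff γ ≠ 0 := hγ.1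
  exact mul_ne_zero h2 (mul_ne_zero (leadingCoeff_ne_zero.2 hz0) hk.1) h1

end Invariant

/-! ### The flow -/

section Flow

open Polynomial in
/-- Every polynomial has a polynomial indefinite sum. -/
theorem exists_polynomial_sum (q : ℝ[X]) :
    ∃ p : ℝ[X], ∀ n : ℕ, p.eval (n : ℝ) = ∑ i ∈ Finset.range n, q.eval (i : ℝ) := by
  induction q using Polynomial.induction_on' with
  | add q q' hq hq' =>
    obtain ⟨p, hp⟩ := hq
    obtain ⟨p', hp'⟩ := hq'
    exact ⟨p + p', fun n => by simp [hp, hp', Finset.sum_add_distrib]⟩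
  | monomial k a =>
    refine ⟨Polynomial.C a * ∑ i ∈ Finset.range (k + 1),
      Polynomial.C (((_root_.bernoulli i * ((k + 1).choose i) / (k + 1) : ℚ)) : ℝ) *
        Polynomial.X ^ (k + 1 - i), fun n => ?_⟩
    have h := congrArg ((↑) : ℚ → ℝ) (sum_range_pow n k)
    push_cast at h
    simp only [Polynomial.eval_mul, Polynomial.eval_C, Polynomial.eval_finsetSum,
      Polynomial.eval_pow, Polynomial.eval_X, Polynomial.eval_monomial, ← Finset.mul_sum]
    rw [h]
    congr 1
    refine Finset.sum_congr rfl fun i _ => ?_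
    push_cast
    ring

theorem lin_zero (m : Exponent → Transseries) : lin m 0 = 0 := by
  simpa using lin_single (m := m) 0 (0 : ℝ)

theorem eps_zero_left (k : ℕ) : eps (0 : Transseries) k = 0 := by
  induction k with
  | zero => rfl
  | succ k ih =>
    obtain ⟨η, -, h⟩ := lg_eq (x := (0 : Transseries)) (by simp)
    obtain ⟨η', -, h'⟩ := pw_eq (x := (0 : Transseries)) (by simp) (-1)
    rw [eps, ih, h, zero_mul, mul_zero, neg_zero, h', zero_mul, add_zero, sub_self]

theorem mon_zero_left (γ : Exponent) : mon (0 : Transseries) γ = single γ 1 := by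
  rw [mon, Finsupp.prod, Finset.prod_eq_one, mul_one]
  intro k _
  obtain ⟨η', -, h'⟩ := pw_eq (x := (0 : Transseries)) (by simp) (ofLex γ k)
  rw [eps_zero_left, h', zero_mul, add_zero]

theorem lin_mon_zero (g : Transseries) : lin (mon 0) g = g := by
  obtain ⟨s, hs, hs'⟩ := exists_family_monomials g
  conv_rhs => rw [← hs']
  symm
  refine hsum_eq_lin s fun γ => ?_
  rw [hs, mon_zero_left]
  ext β
  simp [coeff_single]

variable {z : Transseries}

/-- The `n`-th iterate of `x (1 + z)` is `x (1 + iterRem z n)`. -/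
noncomputable def iterRem (z : Transseries) : ℕ → Transseries
  | 0 => 0
  | n + 1 => star z (iterRem z n)

theorem support_star {N : ℕ} {w : Transseries} (hw : 0 < w.orderTop) (hwN : w.support ⊆ depth N)
    (hzN : z.support ⊆ depth N) : (star w z).support ⊆ depth N := by
  have h := support_lin_mon hw hwN hzN
  exact support_add_subset_of_mem (L := (depth N).toAddSubmonoid)
    (support_add_subset_of_mem (L := (depth N).toAddSubmonoid) hwN h)
    (support_mul_subset_of_mem (L := (depth N).toAddSubmonoid) hwN h)

theorem iterRem_props {N : ℕ} (hz : 0 < z.orderTop) (hzN : z.support ⊆ depth N) (n : ℕ) :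
    0 < (iterRem z n).orderTop ∧ (iterRem z n).support ⊆ depth N := by
  induction n with
  | zero => exact ⟨by simp [iterRem], by simp [iterRem]⟩
  | succ n ih => exact ⟨star_pos hz ih.1 ih.2, support_star hz hzN ih.2⟩

theorem iterRem_one (z : Transseries) : iterRem z 1 = z := by
  simp [iterRem, star, lin_zero]

theorem X_mul_iterRem_succ {N : ℕ} (hz : 0 < z.orderTop) (hzN : z.support ⊆ depth N) (n : ℕ) :
    X * (1 + iterRem z (n + 1)) = lin (mon z) (X * (1 + iterRem z n)) := by
  rw [X_mul_star hz (iterRem_props hz hzN n).2, iterRem]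

theorem X_mul_support {N : ℕ} {y : Transseries} (hy : y.support ⊆ depth N) :
    (X * (1 + y)).support ⊆ depth N :=
  support_mul_subset_of_mem (L := (depth N).toAddSubmonoid) (X_support_subset N)
    (one_add_support_subset hy)

theorem coeff_X_mul (y : Transseries) (β : Exponent) :
    (X * y).coeff β = y.coeff (β - unitExp 0) := by
  rw [X, coeff_single_mul, one_mul]

theorem coeff_mon_self (hz : 0 < z.orderTop) (hz0 : z ≠ 0) {γ : Exponent} (hγ : γ ≠ 0) :
    (mon z γ).coeff γ = 1 := by
  obtain ⟨k, hk⟩ := exists_isLead hγ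
  rw [(coeff_mon hz hz0 hk).1, coeff_single_same]
  have h1 : 0 < z.order := (zero_lt_orderTop_iff hz0).1 hz
  have h2 : 0 ≤ sig k := by
    have := sig_strictMono.monotone (Nat.zero_le k)
    rwa [sig_zero] at this
  rw [add_assoc]
  exact lt_add_of_pos_right _ (add_pos_of_nonneg_of_pos h2 h1)

theorem support_iterRem {N : ℕ} (hz : 0 < z.orderTop) (hzN : z.support ⊆ depth N) (n : ℕ) :
    (iterRem z n).support ⊆ genSubmonoid z N := by
  induction n with
  | zero => simp [iterRem]
  | succ n ih =>
    have h : (lin (mon z) (iterRem z n)).support ⊆ genSubmonoid z N := by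
      intro β hβ
      obtain ⟨γ, h1, h2⟩ := support_lin (shiftBounded_mon hz N) (iterRem_props hz hzN n).2 hβ
      have := add_mem (ih h1) h2
      simpa using this
    have hzg := support_subset_gen z N
    exact support_add_subset_of_mem (support_add_subset_of_mem hzg h)
      (support_mul_subset_of_mem hzg h)

/-- The coefficients of the iterates are polynomial in the number of iterations: the difference of
the coefficients at `β` of two consecutive iterates is a finite combination of coefficients at
smaller exponents, so this follows by induction on `β`. -/
theorem exists_polynomial_coeff {N : ℕ} (hz : 0 < z.orderTop) (hz0 : z ≠ 0)
    (hzN : z.support ⊆ depth N) {β : Exponent} (hβ : β - unitExp 0 ∈ genSubmonoid z N) :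
    ∃ p : Polynomial ℝ, ∀ n : ℕ, (X * (1 + iterRem z n)).coeff β = p.eval (n : ℝ) := by
  classical
  set A : Set Exponent := {β | β - unitExp 0 ∈ genSubmonoid z N}
  have hA : A.IsPWO := by
    have := (Set.isPWO_singleton (unitExp 0)).add (isPWO_genSubmonoid hz N)
    exact this.mono fun β hβ => ⟨_, rfl, _, hβ, add_sub_cancel _ _⟩
  have hsub : ∀ n, (X * (1 + iterRem z n)).support ⊆ A := by
    intro n β hβ
    rw [mem_support, coeff_X_mul] at hβ
    exact support_add_subset_of_mem (support_one_subset _) (support_iterRem hz hzN n) hβ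
  refine Set.WellFoundedOn.induction hA.isWF (P := fun β => ∃ p : Polynomial ℝ,
    ∀ n : ℕ, (X * (1 + iterRem z n)).coeff β = p.eval (n : ℝ)) hβ ?_
  intro β hβ ih
  have hch : ∀ γ, ∃ p : Polynomial ℝ, γ ∈ A → γ < β →
      ∀ n : ℕ, (X * (1 + iterRem z n)).coeff γ = p.eval (n : ℝ) := by
    intro γ
    by_cases h : γ ∈ A ∧ γ < β
    · obtain ⟨p, hp⟩ := ih γ h.1 h.2
      exact ⟨p, fun _ _ => hp⟩
    · exact ⟨0, fun h1 h2 => absurd ⟨h1, h2⟩ h⟩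
  choose p hp using hch
  set T := (finite_sub_mem hA (isPWO_genSubmonoid hz N) β).toFinset
  have hβ0 : β ≠ 0 := by
    have h1 : 0 ≤ β - unitExp 0 := genSubmonoid_nonneg hz N _ hβ
    have h2 := add_pos_of_nonneg_of_pos h1 (unitExp_pos 0)
    rw [sub_add_cancel] at h2
    exact h2.ne'
  have hβT : β ∈ T := by
    simp only [T, Set.Finite.mem_toFinset]
    exact ⟨hβ, by rw [sub_self]; exact (genSubmonoid z N).zero_mem⟩
  obtain ⟨P, hP⟩ := exists_polynomial_sum
    (∑ γ ∈ T.erase β, Polynomial.C ((mon z γ).coeff β) * p γ)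
  have hdiff : ∀ n : ℕ, (X * (1 + iterRem z (n + 1))).coeff β =
      (X * (1 + iterRem z n)).coeff β +
        (∑ γ ∈ T.erase β, Polynomial.C ((mon z γ).coeff β) * p γ).eval (n : ℝ) := by
    intro n
    rw [X_mul_iterRem_succ hz hzN, coeff_lin_eq_sum (shiftBounded_mon hz N)
      (X_mul_support (iterRem_props hz hzN n).2) hA (hsub n), ← Finset.add_sum_erase _ _ hβT,
      coeff_mon_self hz hz0 hβ0, mul_one, Polynomial.eval_finsetSum]
    congr 1
    refine Finset.sum_congr rfl fun γ hγ => ?_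
    rw [Finset.mem_erase, Set.Finite.mem_toFinset] at hγ
    have hlt : γ < β := lt_of_le_of_ne
      (sub_nonneg.1 (genSubmonoid_nonneg hz N _ hγ.2.2)) hγ.1
    rw [hp γ hγ.2.1 hlt, Polynomial.eval_mul, Polynomial.eval_C, mul_comm]
  refine ⟨Polynomial.C ((X * (1 + iterRem z 0)).coeff β) + P, fun n => ?_⟩
  rw [Polynomial.eval_add, Polynomial.eval_C, hP]
  induction n with
  | zero => simp
  | succ n ihn => rw [hdiff, ihn, Finset.sum_range_succ]; ring

theorem exists_eval_mem_support {F : HahnSeries Exponent (Polynomial ℝ)} {γ : Exponent}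
    (hγ : γ ∈ F.support) :
    ∃ n : ℕ, γ ∈ (mapHom (Polynomial.evalRingHom (n : ℝ)) F).support := by
  by_contra! h
  refine hγ (Polynomial.eq_of_infinite_eval_eq _ _ ?_)
  refine (Set.infinite_range_of_injective (f := ((↑) : ℕ → ℝ)) Nat.cast_injective).mono ?_
  rintro _ ⟨n, rfl⟩
  simpa using h n

/-- The iterates of `x (1 + z)` extend to a family which is polynomial in the number of
iterations. -/
theorem exists_polynomial_flow {N : ℕ} (hz : 0 < z.orderTop) (hz0 : z ≠ 0)
    (hzN : z.support ⊆ depth N) :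
    ∃ Z : HahnSeries Exponent (Polynomial ℝ), 0 < Z.orderTop ∧
      Z.support ⊆ genSubmonoid z N ∧
      ∀ n : ℕ, mapHom (Polynomial.evalRingHom (n : ℝ)) Z = iterRem z n := by
  classical
  have h : ∀ γ, ∃ p : Polynomial ℝ, (γ ∉ genSubmonoid z N → p = 0) ∧
      ∀ n : ℕ, (iterRem z n).coeff γ = p.eval (n : ℝ) := by
    intro γ
    by_cases hγ : γ ∈ genSubmonoid z N
    · obtain ⟨p, hp⟩ := exists_polynomial_coeff hz hz0 hzN (β := unitExp 0 + γ) (by simpa using hγ)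
      simp only [coeff_X_mul, add_sub_cancel_left, coeff_add] at hp
      refine ⟨p - Polynomial.C ((1 : Transseries).coeff γ), fun h => absurd hγ h, fun n => ?_⟩
      rw [Polynomial.eval_sub, ← hp, Polynomial.eval_C]
      ring
    · refine ⟨0, fun _ => rfl, fun n => ?_⟩
      rw [Polynomial.eval_zero]
      by_contra h'
      exact hγ (support_iterRem hz hzN n h')
  choose p hp0 hp using h
  have hsub : Function.support p ⊆ genSubmonoid z N := fun γ hγ => by
    by_contra h
    exact hγ (hp0 γ h)
  set Z : HahnSeries Exponent (Polynomial ℝ) :=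
    ⟨p, (isPWO_genSubmonoid hz N).mono hsub⟩
  have hev : ∀ n : ℕ, mapHom (Polynomial.evalRingHom (n : ℝ)) Z = iterRem z n := by
    intro n
    ext γ
    exact (hp γ n).symm
  refine ⟨Z, orderTop_pos_iff.2 fun γ hγ => ?_, hsub, hev⟩
  obtain ⟨n, hn⟩ := exists_eval_mem_support hγ
  rw [hev] at hn
  exact orderTop_pos_iff.1 (iterRem_props hz hzN n).1 γ hn

/-- The evaluation of the coefficients at a real number, as an algebra homomorphism. -/
noncomputable def evalAt (t : ℝ) : Polynomial ℝ →ₐ[ℝ] ℝ := Polynomial.aeval t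

theorem evalAt_apply (t : ℝ) (p : Polynomial ℝ) : evalAt t p = p.eval t := by
  rw [evalAt, Polynomial.coe_aeval_eq_eval]

theorem evalAt_eq (t : ℝ) : (evalAt t : Polynomial ℝ →+* ℝ) = Polynomial.evalRingHom t :=
  RingHom.ext fun p => evalAt_apply t p

theorem mapHom_eval_C (t : ℝ) (g : Transseries) :
    mapHom (Polynomial.evalRingHom t) (mapHom Polynomial.C g) = g := by
  ext γ; simp

/-- For a fixed transseries `g`, the composition `g ∘ (x (1 + Z_t))` depends polynomially on `t`. -/
theorem lin_mon_eval {N : ℕ} {Z : HahnSeries Exponent (Polynomial ℝ)} (hZ : 0 < Z.orderTop)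
    {g : Transseries} (hg : g.support ⊆ depth N) (t : ℝ) :
    lin (mon (mapHom (Polynomial.evalRingHom t) Z)) g =
      mapHom (Polynomial.evalRingHom t) (lin (mon Z) (mapHom Polynomial.C g)) := by
  rw [mapHom_lin _ (shiftBounded_mon hZ N) ((support_mapHom _ _).trans hg), mapHom_eval_C]
  congr 1
  funext γ
  have := mapHom_mon (evalAt t) hZ γ
  rw [evalAt_eq] at this
  exact this.symm

variable {N : ℕ} {Z : HahnSeries Exponent (Polynomial ℝ)}

theorem X_mul_injective {y y' : Transseries} (h : X * (1 + y) = X * (1 + y')) : y = y' := by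
  have hX : X ≠ 0 := single_ne_zero one_ne_zero
  exact add_left_cancel (mul_left_cancel₀ hX h)

open Polynomial in
theorem lin_mon_X_mul_eval (hz : 0 < z.orderTop) (hzN : z.support ⊆ depth N)
    (hZN : Z.support ⊆ depth N)
    (hev : ∀ n : ℕ, mapHom (evalRingHom (n : ℝ)) Z = iterRem z n) (t : ℝ) :
    lin (mon z) (X * (1 + mapHom (evalRingHom t) Z)) =
      X * (1 + mapHom (evalRingHom (t + 1)) Z) := by
  set F : HahnSeries Exponent ℝ[X] := single (unitExp 0) 1 * (1 + Z)
  have hF : ∀ t : ℝ, mapHom (evalRingHom t) F =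
      X * (1 + mapHom (evalRingHom t) Z) := by
    intro t
    simp only [F, map_mul, map_add, mapHom_single, X]
    rw [map_one (evalRingHom t), map_one (mapHom _)]
  have hFN : F.support ⊆ (depth N).toAddSubmonoid :=
    support_mul_subset_of_mem (support_single_subset_of_mem
      (unitExp_mem_depth (Nat.zero_le N)) _)
      (support_add_subset_of_mem (support_one_subset _) hZN)
  have hm : ShiftBounded (genSubmonoid z N) (depth N).toAddSubmonoid
      (fun γ => mapHom Polynomial.C (mon z γ)) :=
    ⟨(shiftBounded_mon hz N).1, fun γ hγ β hβ =>
      (shiftBounded_mon hz N).2 γ hγ β (support_mapHom _ _ hβ)⟩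
  have hL : ∀ t : ℝ, mapHom (evalRingHom t) (lin (fun γ => mapHom Polynomial.C (mon z γ)) F) =
      lin (mon z) (X * (1 + mapHom (evalRingHom t) Z)) := by
    intro t
    rw [mapHom_lin _ hm hFN, hF]
    congr 1
    funext γ
    exact mapHom_eval_C t _
  have hR : ∀ t : ℝ, mapHom (evalRingHom t) (mapHom (compRingHom (Polynomial.X + 1)) F) =
      X * (1 + mapHom (evalRingHom (t + 1)) Z) := by
    intro t
    rw [← hF]
    ext γ
    simp
  rw [← hL, ← hR]
  congr 1
  refine mapHom_eval_ext fun n => ?_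
  rw [hL, hR, hev, ← X_mul_iterRem_succ hz hzN, ← hev]
  norm_cast

theorem lin_mon_iterRem (hz : 0 < z.orderTop) (hzN : z.support ⊆ depth N)
    (hZN : Z.support ⊆ depth N)
    (hev : ∀ n : ℕ, mapHom (Polynomial.evalRingHom (n : ℝ)) Z = iterRem z n) (t : ℝ) (n : ℕ) :
    lin (mon (iterRem z n)) (X * (1 + mapHom (Polynomial.evalRingHom t) Z)) =
      X * (1 + mapHom (Polynomial.evalRingHom (t + n)) Z) := by
  induction n with
  | zero => simp [iterRem, lin_mon_zero]
  | succ n ih =>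
    obtain ⟨h1, h2⟩ := iterRem_props hz hzN n
    rw [iterRem, ← lin_mon_lin_mon hz h1 h2 (X_mul_support ((support_mapHom _ _).trans hZN)), ih,
      lin_mon_X_mul_eval hz hzN hZN hev]
    push_cast
    rw [add_assoc]

open Polynomial in
/-- The flow law. Both sides are polynomial in `s`, so it reduces to natural `s`, that is to the
composition with the iterates of `x (1 + z)`. -/
theorem star_eval (hz : 0 < z.orderTop) (hzN : z.support ⊆ depth N)
    (hZ : 0 < Z.orderTop) (hZN : Z.support ⊆ depth N)
    (hev : ∀ n : ℕ, mapHom (evalRingHom (n : ℝ)) Z = iterRem z n) (s t : ℝ) :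
    star (mapHom (evalRingHom s) Z) (mapHom (evalRingHom t) Z) =
      mapHom (evalRingHom (s + t)) Z := by
  have hN : ∀ t : ℝ, (mapHom (evalRingHom t) Z).support ⊆ depth N :=
    fun t => (support_mapHom _ _).trans hZN
  apply X_mul_injective
  rw [← X_mul_star (orderTop_mapHom_pos _ hZ) (hN t), lin_mon_eval hZ (X_mul_support (hN t))]
  have hR : ∀ s : ℝ, mapHom (evalRingHom s) (mapHom (compRingHom (Polynomial.X + Polynomial.C t))
      (single (unitExp 0) 1 * (1 + Z))) = X * (1 + mapHom (evalRingHom (s + t)) Z) := by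
    intro s
    have : X * (1 + mapHom (evalRingHom (s + t)) Z) =
        mapHom (evalRingHom (s + t)) (single (unitExp 0) 1 * (1 + Z)) := by
      simp only [map_mul, map_add, mapHom_single, X]
      rw [map_one (evalRingHom (s + t)), map_one (mapHom _)]
    rw [this]
    ext γ
    simp only [coeff_mapHom, Polynomial.coe_evalRingHom, Polynomial.coe_compRingHom,
      Polynomial.eval_comp, Polynomial.eval_add, Polynomial.eval_X, Polynomial.eval_C]
  rw [← hR]
  congr 1
  refine mapHom_eval_ext fun n => ?_
  rw [← lin_mon_eval hZ (X_mul_support (hN t)), hR, hev, lin_mon_iterRem hz hzN hZN hev,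
    add_comm t]

theorem lin_mon_iterRem_of_add_one (hz : 0 < z.orderTop) (hzN : z.support ⊆ depth N)
    {Ψ : Transseries} (hΨN : Ψ.support ⊆ depth N) (hΨ : lin (mon z) Ψ = Ψ + 1) (n : ℕ) :
    lin (mon (iterRem z n)) Ψ = Ψ + const n := by
  induction n with
  | zero => simp [iterRem, lin_mon_zero, const]
  | succ n ih =>
    obtain ⟨h1, h2⟩ := iterRem_props hz hzN n
    have hc : (const (n : ℝ)).support ⊆ depth N :=
      support_single_subset_of_mem (L := (depth N).toAddSubmonoid) (depth N).zero_mem _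
    have hc' : lin (mon z) (const (n : ℝ)) = const n := by
      rw [const, C_apply, lin_single, mon_zero]
      ext γ
      simp [coeff_single, coeff_one]
    rw [iterRem, ← lin_mon_lin_mon hz h1 h2 hΨN, ih, lin_add (shiftBounded_mon hz N) hΨN hc, hΨ,
      hc']
    simp only [const]
    push_cast
    rw [map_add, map_one]
    ring

/-- A solution of `Ψ ∘ f = Ψ + 1` satisfies `Ψ ∘ fᵗ = Ψ + t`: both sides are polynomial in `t` and
agree for natural `t`. -/
theorem lin_mon_eval_of_add_one (hz : 0 < z.orderTop) (hzN : z.support ⊆ depth N)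
    (hZ : 0 < Z.orderTop)
    (hev : ∀ n : ℕ, mapHom (Polynomial.evalRingHom (n : ℝ)) Z = iterRem z n)
    {Ψ : Transseries} (hΨN : Ψ.support ⊆ depth N) (hΨ : lin (mon z) Ψ = Ψ + 1) (t : ℝ) :
    lin (mon (mapHom (Polynomial.evalRingHom t) Z)) Ψ = Ψ + const t := by
  have hR : ∀ t : ℝ, mapHom (Polynomial.evalRingHom t)
      (mapHom Polynomial.C Ψ + C Polynomial.X) = Ψ + const t := by
    intro t
    rw [map_add, mapHom_eval_C, C_apply, mapHom_single]
    simp [const, C_apply]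
  rw [lin_mon_eval hZ hΨN, ← hR]
  congr 1
  refine mapHom_eval_ext fun n => ?_
  rw [← lin_mon_eval hZ hΨN, hev, hR]
  exact lin_mon_iterRem_of_add_one hz hzN hΨN hΨ n

theorem coeff_iterRem_order (hz : 0 < z.orderTop) (hz0 : z ≠ 0) (hzN : z.support ⊆ depth N)
    (n : ℕ) : (∀ γ ∈ (iterRem z n).support, z.order ≤ γ) ∧
      (iterRem z n).coeff z.order = z.leadingCoeff * n := by
  have hpos : 0 < z.order := (zero_lt_orderTop_iff hz0).1 hz
  have hzle : ∀ γ ∈ z.support, z.order ≤ γ := fun γ h => order_le_of_coeff_ne_zero h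
  induction n with
  | zero => simp [iterRem]
  | succ n ih =>
    set y := iterRem z n
    have hyN := (iterRem_props hz hzN n).2
    have hle : ∀ γ ∈ (lin (mon z) y).support, z.order ≤ γ := by
      intro γ hγ
      obtain ⟨β, h1, h2⟩ := support_lin (shiftBounded_mon hz N) hyN hγ
      have := add_le_add (ih.1 β h1) (genSubmonoid_nonneg hz N _ h2)
      simpa using this
    have hmul : ∀ γ ∈ (z * lin (mon z) y).support, z.order < γ := by
      intro γ hγ
      obtain ⟨a, ha, b, hb, rfl⟩ := support_mul_subset hγ
      exact lt_add_of_le_of_pos (hzle a ha) (hpos.trans_le (hle b hb))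
    constructor
    · intro γ hγ
      rcases support_add_subset _ _ hγ with h | h
      · rcases support_add_subset _ _ h with h | h
        exacts [hzle γ h, hle γ h]
      · exact (hmul γ h).le
    · have h1 : (lin (mon z) y).coeff z.order = y.coeff z.order := by
        rw [coeff_lin (shiftBounded_mon hz N) hyN, finsum_eq_single _ z.order,
          coeff_mon_self hz hz0 hpos.ne', mul_one]
        intro γ hγ
        by_contra h
        have h2 := left_ne_zero_of_mul h
        have h3 := (shiftBounded_mon hz N).2 γ (hyN h2) _ (right_ne_zero_of_mul h)
        have h4 := sub_nonneg.1 (genSubmonoid_nonneg hz N _ h3)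
        exact hγ (le_antisymm h4 (ih.1 γ h2))
      have h2 : (z * lin (mon z) y).coeff z.order = 0 := by
        by_contra h
        exact lt_irrefl _ (hmul _ h)
      rw [iterRem, star, coeff_add, coeff_add, h1, h2, ih.2, ← leadingCoeff_eq]
      push_cast
      ring

/-- The time can be read off from the leading coefficient of the remainder. -/
theorem coeff_eval_order (hz : 0 < z.orderTop) (hz0 : z ≠ 0) (hzN : z.support ⊆ depth N)
    (hev : ∀ n : ℕ, mapHom (Polynomial.evalRingHom (n : ℝ)) Z = iterRem z n) (t : ℝ) :
    (mapHom (Polynomial.evalRingHom t) Z).coeff z.order = z.leadingCoeff * t := by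
  have h : Z.coeff z.order = Polynomial.C z.leadingCoeff * Polynomial.X := by
    refine Polynomial.eq_of_infinite_eval_eq _ _ ?_
    refine (Set.infinite_range_of_injective (f := ((↑) : ℕ → ℝ)) Nat.cast_injective).mono ?_
    rintro _ ⟨n, rfl⟩
    have h1 := (coeff_iterRem_order hz hz0 hzN n).2
    rw [← hev] at h1
    simpa using h1
  simp [h]

open scoped Pointwise in
/-- The family `x (1 + Z_t)` is a `C¹` flow in `LHat`. -/
theorem isC1Flow_eval (hz : 0 < z.orderTop) (hzg : Good z.support)
    (hZ : 0 < Z.orderTop) (hZS : Z.support ⊆ genSubmonoid z 1)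
    (hev : ∀ n : ℕ, mapHom (Polynomial.evalRingHom (n : ℝ)) Z = iterRem z n) :
    IsC1Flow fun t => X * (1 + mapHom (Polynomial.evalRingHom t) Z) := by
  have hzN : z.support ⊆ depth 1 := hzg.depth
  have hZN : Z.support ⊆ depth 1 := hZS.trans (genSubmonoid_le_depth hzN)
  have hsub : ∀ t : ℝ, (X * (1 + mapHom (Polynomial.evalRingHom t) Z)).support ⊆
      {unitExp 0} + (genSubmonoid z 1 : Set Exponent) := by
    intro t γ hγ
    rw [mem_support, coeff_X_mul] at hγ
    exact ⟨_, rfl, _, support_add_subset_of_mem (support_one_subset (genSubmonoid z 1))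
      ((support_mapHom _ _).trans hZS) hγ, add_sub_cancel _ _⟩
  have hX : unitExp 0 ∈ depth 1 := unitExp_mem_depth (Nat.zero_le 1)
  refine ⟨fun t => ?_, ?_, fun s t => ?_, ?_, ?_⟩
  · rw [mem_LHat_iff]
    refine ⟨((good_singleton hX ⟨0, by simp [unitExp_apply]⟩).add
      (good_genSubmonoid hz hzg)).mono (hsub t), fun γ hγ => ?_⟩
    obtain ⟨_, rfl, σ, hσ, rfl⟩ := hsub t hγ
    have h := apply_zero_le_of_le (genSubmonoid_nonneg hz 1 σ hσ)
    rw [exponent_zero_apply] at h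
    have h2 : ofLex (unitExp 0) 0 = 1 := by simp [unitExp_apply]
    change 0 < ofLex (unitExp 0 + σ) 0
    rw [exponent_add_apply, h2]
    linarith
  · have := hev 0
    rw [Nat.cast_zero] at this
    simp [this, iterRem]
  · have hs := orderTop_mapHom_pos (Polynomial.evalRingHom s) hZ
    have ht := (support_mapHom (Polynomial.evalRingHom t) Z).trans hZN
    rw [isComp_iff hs (X_mul_support ht), X_mul_star hs ht, star_eval hz hzN hZ hZN hev,
      add_comm s t]
  · exact (((Set.isPWO_singleton (unitExp 0)).add (isPWO_genSubmonoid hz 1)).mono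
      (Set.iUnion_subset hsub)).isWF
  · intro γ _
    simp only [coeff_X_mul, coeff_add, coeff_mapHom, Polynomial.coe_evalRingHom]
    have h := Polynomial.contDiff_aeval (𝕜 := ℝ) (Z.coeff (γ - unitExp 0)) 1
    simp only [Polynomial.coe_aeval_eq_eval] at h
    exact contDiff_const.add h

end Flow

/-! ### Existence of a Fatou coordinate -/

section Triangular

variable {Γ : Type*} [AddCommGroup Γ] [LinearOrder Γ] [IsOrderedAddMonoid Γ]

open Classical in
/-- A triangular system of linear equations indexed by a well-ordered set is solvable. -/
theorem exists_triangular_solution {W D : Set Γ} (hW : W.IsPWO) (hD : D.IsPWO)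
    (hD0 : ∀ d ∈ D, 0 ≤ d) (h0 : (0 : Γ) ∈ D) (hWD : ∀ w ∈ W, ∀ d ∈ D, w + d ∈ W) (K : Γ → Γ → ℝ)
    (hK : ∀ β' ∈ W, ∀ β, K β' β ≠ 0 → β - β' ∈ D) (hdiag : ∀ β ∈ W, K β β ≠ 0)
    (b : Γ → ℝ) (hb : ∀ β ∉ W, b β = 0) :
    ∃ y : Γ → ℝ, (∀ β ∉ W, y β = 0) ∧ ∀ β, ∑ᶠ β', y β' * K β' β = b β := by
  have wf : WellFounded fun a b : W => (a : Γ) < b := hW.isWF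
  set T : Γ → Finset Γ := fun β => (finite_sub_mem hW hD β).toFinset
  set Y : W → ℝ := wf.fix fun β rec => (b β - ∑ β' ∈ (T β).erase β,
    (if h : ∃ h : β' ∈ W, β' < (β : Γ) then rec ⟨β', h.1⟩ h.2 else 0) * K β' β) / K β β
  set y : Γ → ℝ := fun γ => if h : γ ∈ W then Y ⟨γ, h⟩ else 0
  have hy : ∀ β ∉ W, y β = 0 := fun β h => dif_neg h
  have hyW : ∀ β ∈ W, y β = (b β - ∑ β' ∈ (T β).erase β, y β' * K β' β) / K β β := by
    intro β hβ
    simp only [y, dif_pos hβ]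
    rw [show Y ⟨β, hβ⟩ = _ from wf.fix_eq _ _]
    congr 2
    refine Finset.sum_congr rfl fun β' hβ' => ?_
    rw [Finset.mem_erase, Set.Finite.mem_toFinset] at hβ'
    have hlt : β' < β := lt_of_le_of_ne (sub_nonneg.1 (hD0 _ hβ'.2.2)) hβ'.1
    rw [dif_pos ⟨hβ'.2.1, hlt⟩, dif_pos hβ'.2.1]
  refine ⟨y, hy, fun β => ?_⟩
  by_cases hβ : β ∈ W
  · have hsub : (Function.support fun β' => y β' * K β' β) ⊆ T β := by
      intro β' h
      have h1 : β' ∈ W := by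
        by_contra h'
        exact left_ne_zero_of_mul h (hy _ h')
      simpa [T] using ⟨h1, hK β' h1 β (right_ne_zero_of_mul h)⟩
    have hβT : β ∈ T β := by simpa [T] using ⟨hβ, h0⟩
    rw [finsum_eq_sum_of_support_subset _ hsub, ← Finset.add_sum_erase _ _ hβT, hyW β hβ,
      div_mul_cancel₀ _ (hdiag β hβ), sub_add_cancel]
  · rw [hb β hβ]
    refine finsum_eq_zero_of_forall_eq_zero fun β' => ?_
    by_contra h
    have h1 : β' ∈ W := by
      by_contra h'
      exact left_ne_zero_of_mul h (hy _ h')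
    have := hWD β' h1 _ (hK β' h1 β (right_ne_zero_of_mul h))
    exact hβ (by simpa using this)

end Triangular

section Fatou

variable {z : Transseries}

theorem mon_neg_unitExp_two (hz : 0 < z.orderTop) :
    mon z (-unitExp 2) = single (-unitExp 2) 1 - lg (eps z 1) := by
  have h1 : mon z (-unitExp 2) * mon z (unitExp 2) = 1 := by
    rw [← mon_add, neg_add_cancel, mon_zero]
  rw [mon_unitExp hz] at h1
  have h2 := one_add_eps_succ_mul hz 1
  have h3 : (single (-unitExp 2) (1 : ℝ)) * single (unitExp 2) 1 = 1 := by
    rw [single_mul_single, neg_add_cancel, one_mul, single_zero_one]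
  rw [show 1 + 1 = 2 from rfl] at h2
  set a := mon z (-unitExp 2)
  set u := single (unitExp 2) (1 : ℝ)
  set v := single (-unitExp 2) (1 : ℝ)
  set L := lg (eps z 1)
  set p := eps z 2
  have h4 : (v - L) * (u * (1 + p)) = 1 := by
    linear_combination h2 + (1 + p) * h3
  linear_combination (v - L) * h1 - a * h4

open Classical in
/-- The exponent of the monomial whose increment under substitution of `x (1 + z)`, `ord z = ω`, has
leading exponent `β`. It is `-unitExp 2` if a logarithm `ℓ₂⁻¹ = -log ℓ₁` is needed. -/
noncomputable def primExp (ω β : Exponent) : Exponent :=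
  if ofLex (β - ω) 0 ≠ 0 then β - ω
  else if β - ω = unitExp 1 then -unitExp 2 else β - ω - unitExp 1

theorem primExp_cases (ω β : Exponent) :
    primExp ω β = β - ω ∨ primExp ω β = β - ω - unitExp 1 ∨
      (β - ω = unitExp 1 ∧ primExp ω β = -unitExp 2) := by
  rw [primExp]
  split_ifs with h1 h2
  · exact Or.inl rfl
  · exact Or.inr (Or.inr ⟨h2, rfl⟩)
  · exact Or.inr (Or.inl rfl)

theorem primExp_isLead {ω β : Exponent} (h : β - ω ∈ depth 1) :
    ∃ k, IsLead (primExp ω β) k ∧ primExp ω β + sig k + ω = β := by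
  rw [primExp]
  split_ifs with h1 h2
  · exact ⟨0, ⟨h1, by simp⟩, by simp⟩
  · refine ⟨2, ⟨?_, fun j hj => ?_⟩, ?_⟩
    · rw [exponent_neg_apply, unitExp_apply, if_pos rfl]
      norm_num
    · rw [exponent_neg_apply, unitExp_apply, if_neg (by omega), neg_zero]
    · rw [sig_succ, sig_one, ← h2]
      abel
  · rw [not_not] at h1
    refine ⟨1, ⟨fun h3 => h2 (sub_eq_zero.1 (exponent_ext fun j => ?_)), fun j hj => ?_⟩, ?_⟩
    · rcases j with _ | _ | j
      · rw [exponent_sub_apply, h1, unitExp_apply]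
        simp
      · exact h3
      · exact sub_mem h (unitExp_mem_depth le_rfl) _ (by omega)
    · rw [Nat.lt_one_iff.1 hj, exponent_sub_apply, h1, unitExp_apply]
      simp
    · rw [sig_one]
      abel

open scoped Pointwise in
/-- The equation `Ψ ∘ f = Ψ + 1` is solvable for `f = x (1 + z)`. The increments of the monomials
with exponents `primExp ω β` have the leading exponents `β`, so the equation is a triangular system
for the coefficients of `Ψ`. -/
theorem exists_lin_mon_eq_add_one (hz : 0 < z.orderTop) (hz0 : z ≠ 0) (hzg : Good z.support) :
    ∃ Ψ : Transseries, (∃ G, Good G ∧ Ψ.support ⊆ insert (-unitExp 2) G) ∧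
      Ψ.support ⊆ depth 2 ∧ lin (mon z) Ψ = Ψ + 1 := by
  set ω := z.order
  set S := genSubmonoid z 1
  have hzN : z.support ⊆ depth 1 := hzg.depth
  have hS : Good (S : Set Exponent) := good_genSubmonoid hz hzg
  have hSpwo : (S : Set Exponent).IsPWO := isPWO_genSubmonoid hz 1
  have hωz : ω ∈ z.support := by
    rw [mem_support]
    exact fun h => hz0 (coeff_order_eq_zero.1 h)
  have hω1 : ω ∈ depth 1 := hzN hωz
  have he1 : unitExp 1 ∈ depth 1 := unitExp_mem_depth le_rfl
  have hωS : ω ∈ S := support_subset_gen z 1 hωz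
  obtain ⟨nω, hnω⟩ := hzg.int ω hωz
  have hg1 : Good {-ω} := good_singleton (neg_mem hω1)
    ⟨-nω, by rw [exponent_neg_apply, hnω]; push_cast; ring⟩
  have hg2 : Good {-ω - unitExp 1} := good_singleton (sub_mem (neg_mem hω1) he1)
    ⟨-nω - 1, by
      rw [exponent_sub_apply, exponent_neg_apply, hnω, unitExp_apply, if_pos rfl]
      push_cast
      ring⟩
  set D : Set Exponent := {d | 0 ≤ d ∧ (d + ω ∈ S ∨ d + ω + unitExp 1 ∈ S)}
  have hDsub : D ⊆ ((S : Set Exponent) + {-ω}) ∪ ((S : Set Exponent) + {-ω - unitExp 1}) := by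
    rintro d ⟨-, h | h⟩
    · exact Or.inl ⟨_, h, _, rfl, add_neg_cancel_right _ _⟩
    · exact Or.inr ⟨_, h, _, rfl, by simp only; abel⟩
  have hDg : Good D := ((hS.add hg1).union (hS.add hg2)).mono hDsub
  have hDpwo : D.IsPWO := ((hSpwo.add (Set.isPWO_singleton _)).union
    (hSpwo.add (Set.isPWO_singleton _))).mono hDsub
  have hD0 : ∀ d ∈ D, 0 ≤ d := fun d h => h.1
  set W := AddSubmonoid.closure D
  have hW : Good (W : Set Exponent) := hDg.closure hD0
  have hWpwo : (W : Set Exponent).IsPWO := Set.IsPWO.addSubmonoid_closure hD0 hDpwo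
  have hWE : ∀ β ∈ W, β - ω ∈ depth 1 := fun β hβ => sub_mem (hW.depth β hβ) hω1
  set E := primExp ω
  have hES : ∀ β ∈ W, ∀ β', (mon z (E β) - single (E β) 1).coeff β' ≠ 0 → β' - β ∈ D := by
    intro β hβ β' h
    obtain ⟨k, hk, hk'⟩ := primExp_isLead (hWE β hβ)
    obtain ⟨hlt, -⟩ := coeff_mon hz hz0 hk
    rw [hk'] at hlt
    have hle : β ≤ β' := by
      by_contra! h'
      exact h (by rw [coeff_sub, hlt β' h', sub_self])
    have hsup : E β ∈ depth 1 → β' - E β ∈ S := by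
      intro hE
      rcases support_sub_subset _ _ h with h1 | h1
      · exact (shiftBounded_mon hz 1).2 _ hE _ h1
      · rw [eq_of_mem_support_single h1, sub_self]
        exact S.zero_mem
    refine ⟨sub_nonneg.2 hle, ?_⟩
    rcases primExp_cases ω β with h1 | h1 | ⟨h1, h2⟩
    · left
      have h3 := hsup (by simp only [E]; rw [h1]; exact hWE β hβ)
      simp only [E] at h3
      rwa [h1, ← sub_add] at h3
    · right
      have h3 := hsup (by simp only [E]; rw [h1]; exact sub_mem (hWE β hβ) he1)
      simp only [E] at h3
      rwa [h1, ← sub_add, ← sub_add] at h3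
    · right
      simp only [E] at h
      rw [h2, mon_neg_unitExp_two hz, sub_sub_cancel_left] at h
      have h3 : β' ∈ S := support_neg_subset_of_mem
        (support_heval_subset (support_eps z le_rfl) _) h
      rwa [← h1, show β' - β + ω + (β - ω) = β' by abel]
  have hdiag : ∀ β ∈ W, (mon z (E β) - single (E β) 1).coeff β ≠ 0 := by
    intro β hβ
    obtain ⟨k, hk, hk'⟩ := primExp_isLead (hWE β hβ)
    obtain ⟨-, heq⟩ := coeff_mon hz hz0 hk
    rw [hk'] at heq
    rw [coeff_sub, heq, add_sub_cancel_left]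
    exact mul_ne_zero (leadingCoeff_ne_zero.2 hz0) hk.1
  obtain ⟨y, hyW, hy⟩ := exists_triangular_solution hWpwo hDpwo hD0
    ⟨le_rfl, Or.inl (by rwa [zero_add])⟩
    (fun w hw d hd => W.add_mem hw (AddSubmonoid.subset_closure hd))
    (fun β β' => (mon z (E β) - single (E β) 1).coeff β') hES hdiag
    (fun β => (1 : Transseries).coeff β)
    (fun β hβ => by
      rw [coeff_one, if_neg]
      rintro rfl
      exact hβ W.zero_mem)
  have hyW' : ∀ β, y β ≠ 0 → β ∈ W := fun β h => by
    by_contra h'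
    exact h (hyW β h')
  set G : Set Exponent := ((W : Set Exponent) + {-ω}) ∪ ((W : Set Exponent) + {-ω - unitExp 1})
  have hG : Good G := (hW.add hg1).union (hW.add hg2)
  have hGpwo : G.IsPWO := (hWpwo.add (Set.isPWO_singleton _)).union
    (hWpwo.add (Set.isPWO_singleton _))
  have hEG : ∀ β ∈ W, E β ∈ insert (-unitExp 2) G := by
    intro β hβ
    rcases primExp_cases ω β with h1 | h1 | ⟨-, h2⟩
    · exact Or.inr (Or.inl ⟨β, hβ, _, rfl, by simp only [E]; rw [h1]; abel⟩)
    · exact Or.inr (Or.inr ⟨β, hβ, _, rfl, by simp only [E]; rw [h1]; abel⟩)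
    · exact Or.inl h2
  have hGN : insert (-unitExp 2) G ⊆ depth 2 := by
    rintro γ (rfl | h)
    · exact neg_mem (unitExp_mem_depth le_rfl)
    · exact depth_mono (by norm_num) (hG.depth γ h)
  have hcoeff : ∀ β γ, (y β • single (E β) (1 : ℝ)).coeff γ ≠ 0 → β ∈ W ∧ E β = γ := by
    intro β γ h
    rw [coeff_smul, smul_eq_mul] at h
    exact ⟨hyW' β (left_ne_zero_of_mul h), (eq_of_mem_support_single (right_ne_zero_of_mul h)).symm⟩
  set s : SummableFamily Exponent ℝ Exponent :=
    { toFun := fun β => y β • single (E β) 1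
      isPWO_iUnion_support' := by
        refine (((Set.isPWO_singleton (-unitExp 2)).union hGpwo)).mono
          (Set.iUnion_subset fun β γ h => ?_)
        obtain ⟨h1, rfl⟩ := hcoeff β γ h
        exact hEG β h1
      finite_co_support' := by
        intro γ
        refine (Set.toFinite {γ + ω, γ + ω + unitExp 1, unitExp 1 + ω}).subset ?_
        intro β h
        obtain ⟨-, h1⟩ := hcoeff β γ h
        rcases primExp_cases ω β with h2 | h2 | ⟨h2, -⟩
        · left
          rw [← h1]; simp only [E]; rw [h2]; abel
        · right; left
          rw [← h1]; simp only [E]; rw [h2]; abel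
        · right; right
          rw [← h2]; simp }
  have hs : ∀ β, s β = y β • single (E β) 1 := fun β => rfl
  have hsG : ∀ β, (s β).support ⊆ insert (-unitExp 2) G := by
    intro β γ h
    obtain ⟨h1, rfl⟩ := hcoeff β γ h
    exact hEG β h1
  have hsup : s.hsum.support ⊆ insert (-unitExp 2) G :=
    (SummableFamily.support_hsum_subset).trans (Set.iUnion_subset hsG)
  refine ⟨s.hsum, ⟨G, hG, hsup⟩, hsup.trans hGN, ?_⟩
  obtain ⟨t, ht, ht'⟩ := lin_hsum (shiftBounded_mon hz 2) s fun β => (hsG β).trans hGN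
  rw [ht', ← sub_eq_iff_eq_add', ← SummableFamily.hsum_sub]
  ext β
  rw [← hy β, SummableFamily.coeff_hsum]
  refine finsum_congr fun β' => ?_
  rw [SummableFamily.sub_apply, ht, hs]
  have : y β' • single (E β') (1 : ℝ) = single (E β') (y β') := by
    ext γ; simp [coeff_single]
  rw [this, lin_single, coeff_sub, coeff_sub, coeff_smul, smul_eq_mul, mul_sub, coeff_single,
    coeff_single]
  split_ifs <;> simp

end Fatou

/-! ### Leading terms of compositions -/

section Leading

/-- `h` has leading term `a m_η` with `a > 0`. -/
def HasLead (h : Transseries) (η : Exponent) (a : ℝ) : Prop :=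
  0 < a ∧ ∃ p, 0 < p.orderTop ∧ h = single η a * (1 + p)

variable {h h' : Transseries} {η η' : Exponent} {a a' : ℝ}

theorem HasLead.order (hh : HasLead h η a) : h.order = η := by
  obtain ⟨ha, p, hp, rfl⟩ := hh
  exact (order_single_mul_one_add ha.ne' hp).1

theorem HasLead.leadingCoeff (hh : HasLead h η a) : h.leadingCoeff = a := by
  obtain ⟨ha, p, hp, rfl⟩ := hh
  exact (order_single_mul_one_add ha.ne' hp).2

theorem hasLead_of_pos (h0 : 0 < h.leadingCoeff) : HasLead h h.order h.leadingCoeff :=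
  have h1 : h ≠ 0 := leadingCoeff_ne_zero.1 h0.ne'
  ⟨h0, _, orderTop_remainder_pos h1, eq_single_mul_remainder h1⟩

theorem HasLead.mul (hh : HasLead h η a) (hh' : HasLead h' η' a') :
    HasLead (h * h') (η + η') (a * a') := by
  obtain ⟨ha, p, hp, rfl⟩ := hh
  obtain ⟨ha', p', hp', rfl⟩ := hh'
  refine ⟨mul_pos ha ha', _, orderTop_pos_one_add_mul hp hp', ?_⟩
  rw [← single_mul_single]
  ring

theorem hasLead_rpow (hh : HasLead h η a) (c : ℝ) :
    HasLead (rpow h c) (c • η) (a ^ c) := by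
  obtain ⟨ha, p, hp, rfl⟩ := hh
  obtain ⟨θ, h1, h2⟩ := pw_eq hp c
  refine ⟨Real.rpow_pos_of_pos ha c, p * (C (algebraMap ℝ ℝ c) + θ),
    orderTop_pos_mul hp (support_add_subset_of_mem (L := nonnegSubmonoid Exponent)
      (support_single_subset_of_mem (nonnegSubmonoid Exponent).zero_mem _)
      (nonneg_of_orderTop_pos h1)), ?_⟩
  rw [rpow_single_mul ha.ne' hp, h2]

theorem hasLead_inv (hh : HasLead h η a) : HasLead h⁻¹ (-η) a⁻¹ := by
  obtain ⟨ha, p, hp, rfl⟩ := hh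
  refine ⟨inv_pos.2 ha, _, pw_neg_one_sub_one_pos hp, ?_⟩
  refine inv_eq_of_mul_eq_one_right ?_
  have h1 := pw_neg_one_mul hp
  have h2 : single η a * single (-η) a⁻¹ = 1 := by
    rw [single_mul_single, add_neg_cancel, mul_inv_cancel₀ ha.ne', single_zero_one]
  linear_combination h1 + pw p (-1) * (1 + p) * h2

theorem unitExp_two_lt_one : unitExp 2 < unitExp 1 := by
  rw [exponent_lt_iff]
  refine ⟨1, fun j hj => ?_, ?_⟩
  · rw [unitExp_apply, unitExp_apply, if_neg (by omega), if_neg (by omega)]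
  · rw [unitExp_apply, unitExp_apply, if_neg (by omega), if_pos rfl]
    exact one_pos

theorem hasLead_negLog (hh : HasLead h η a) (hη : η ∈ depth 1) (h0 : 0 < ofLex η 0) :
    HasLead (negLog h) (-unitExp 1) (ofLex η 0) := by
  obtain ⟨ho, hl⟩ := And.intro hh.order hh.leadingCoeff
  obtain ⟨ha, p, hp, rfl⟩ := hh
  have hsum : ((ofLex η).sum fun k c => single (-unitExp (k + 1)) c) =
      single (-unitExp 1) (ofLex η 0) + single (-unitExp 2) (ofLex η 1) := by
    rw [Finsupp.sum_of_support_subset (s := Finset.range 2)]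
    · simp [Finset.sum_range_succ]
    · intro k hk
      rw [Finset.mem_range]
      by_contra h
      exact Finsupp.mem_support_iff.1 hk (hη k (by omega))
    · simp
  refine ⟨h0, single (unitExp 1 - unitExp 2) ((ofLex η 0)⁻¹ * ofLex η 1) -
    single (unitExp 1) ((ofLex η 0)⁻¹ * Real.log a) -
      single (unitExp 1) (ofLex η 0)⁻¹ * lg p, ?_, ?_⟩
  · refine orderTop_pos_sub (orderTop_pos_sub (orderTop_single_pos
      (sub_pos.2 unitExp_two_lt_one) _) (orderTop_single_pos (unitExp_pos 1) _)) ?_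
    exact orderTop_pos_mul (orderTop_single_pos (unitExp_pos 1) _)
      (nonneg_of_orderTop_pos (orderTop_lg_pos hp))
  · rw [negLog, remainder_single_mul ha.ne' hp, ho, hl, hsum, lg, mul_add, mul_one,
      mul_sub, mul_sub, ← mul_assoc (single _ _) (single _ _), single_mul_single,
      single_mul_single, single_mul_single, mul_inv_cancel_left₀ h0.ne',
      mul_inv_cancel_left₀ h0.ne', mul_inv_cancel₀ h0.ne', neg_add_cancel, const, C_apply,
      show -unitExp 1 + (unitExp 1 - unitExp 2) = -unitExp 2 by abel, single_zero_one]
    ring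

theorem rpow_zero (h : Transseries) : rpow h 0 = 1 := by
  have := pw_zero (remainder h)
  rw [pw] at this
  rw [rpow, this, zero_smul, Real.rpow_zero, single_zero_one, mul_one]

/-- The exponent of the leading term of `m_γ ∘ h` for `h` of order `η`, with `γ` and `η` of
depth one. -/
noncomputable def compOrder (η γ : Exponent) : Exponent :=
  ofLex γ 0 • η + ofLex γ 1 • unitExp 1

theorem compOrder_apply_zero (η γ : Exponent) :
    ofLex (compOrder η γ) 0 = ofLex γ 0 * ofLex η 0 := by
  change ofLex γ 0 * ofLex η 0 + ofLex γ 1 * ofLex (unitExp 1) 0 = _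
  rw [unitExp_apply]
  simp

theorem compOrder_apply_one (η γ : Exponent) :
    ofLex (compOrder η γ) 1 = ofLex γ 0 * ofLex η 1 + ofLex γ 1 := by
  change ofLex γ 0 * ofLex η 1 + ofLex γ 1 * ofLex (unitExp 1) 1 = _
  rw [unitExp_apply]
  simp

theorem compOrder_lt {γ γ' : Exponent} (h0 : 0 < ofLex η 0) (hγ : γ ∈ depth 1)
    (hγ' : γ' ∈ depth 1) (h : γ < γ') : compOrder η γ < compOrder η γ' := by
  obtain ⟨i, h1, h2⟩ := exponent_lt_iff.1 h
  rw [exponent_lt_iff]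
  rcases i with _ | _ | i
  · refine ⟨0, fun j hj => absurd hj (by omega), ?_⟩
    rw [compOrder_apply_zero, compOrder_apply_zero]
    exact mul_lt_mul_of_pos_right h2 h0
  · refine ⟨1, fun j hj => ?_, ?_⟩
    · rw [Nat.lt_one_iff.1 hj, compOrder_apply_zero, compOrder_apply_zero, h1 0 (by omega)]
    · rw [compOrder_apply_one, compOrder_apply_one, h1 0 (by omega)]
      exact add_lt_add_right h2 _
  · rw [hγ _ (by omega), hγ' _ (by omega)] at h2
    exact absurd h2 (lt_irrefl _)

theorem hasLead_monoComp (hh : HasLead h η a) (hη : η ∈ depth 1) (h0 : 0 < ofLex η 0)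
    {γ : Exponent} (hγ : γ ∈ depth 1) :
    HasLead (monoComp γ h) (compOrder η γ) (a ^ ofLex γ 0 * (ofLex η 0)⁻¹ ^ ofLex γ 1) := by
  have h1 : monoComp γ h =
      rpow h (ofLex γ 0) * rpow (negLog h)⁻¹ (ofLex γ 1) := by
    rw [monoComp, Finsupp.prod_of_support_subset (s := Finset.range 2)]
    · simp [Finset.prod_range_succ, ellComp]
    · intro k hk
      rw [Finset.mem_range]
      by_contra h
      exact Finsupp.mem_support_iff.1 hk (hγ k (by omega))
    · exact fun k _ => rpow_zero _
  have h2 := hasLead_inv (hasLead_negLog hh hη h0)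
  rw [neg_neg] at h2
  rw [h1]
  exact (hasLead_rpow hh _).mul (hasLead_rpow h2 _)

/-- The leading term of `g ∘ h` is that of the substitution of `h` into the leading term of `g`. -/
theorem order_of_isComp {g r : Transseries} (hg0 : 0 < g.leadingCoeff) (hg : g.support ⊆ depth 1)
    (hh : h.order ∈ depth 1) (h0 : 0 < ofLex h.order 0) (hr0 : r ≠ 0) (hr : IsComp g h r) :
    r.order = compOrder h.order g.order ∧ r.leadingCoeff = g.leadingCoeff *
      (h.leadingCoeff ^ ofLex g.order 0 * (ofLex h.order 0)⁻¹ ^ ofLex g.order 1) := by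
  obtain ⟨hlc, -, s, hs, rfl⟩ := hr
  have hm := fun γ (hγ : γ ∈ depth 1) => hasLead_monoComp (hasLead_of_pos hlc) hh h0 hγ
  have hg0' : g ≠ 0 := leadingCoeff_ne_zero.1 hg0.ne'
  have hgo : g.order ∈ depth 1 := hg (by
    rw [mem_support]
    exact fun h => hg0' (coeff_order_eq_zero.1 h))
  set β := compOrder h.order g.order
  have hz : ∀ γ, γ ≠ g.order → ∀ β' ≤ β, (s γ).coeff β' = 0 := by
    intro γ hne β' hβ'
    rw [hs, coeff_smul, smul_eq_mul]
    by_contra h'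
    have hγ : γ ∈ g.support := left_ne_zero_of_mul h'
    have h1 := order_le_of_coeff_ne_zero (right_ne_zero_of_mul h')
    rw [(hm γ (hg hγ)).order] at h1
    have h2 := compOrder_lt h0 hgo (hg hγ)
      (lt_of_le_of_ne (order_le_of_coeff_ne_zero hγ) hne.symm)
    exact absurd (h1.trans hβ') (not_le.2 h2)
  have hc : ∀ β' ≤ β, s.hsum.coeff β' = g.leadingCoeff *
      (monoComp g.order h).coeff β' := by
    intro β' hβ'
    rw [SummableFamily.coeff_hsum, finsum_eq_single _ g.order fun γ hγ => hz γ hγ β' hβ', hs,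
      coeff_smul, smul_eq_mul, leadingCoeff_eq]
  have hmo := (hm _ hgo).order
  have hml := (hm _ hgo).leadingCoeff
  rw [leadingCoeff_eq, hmo] at hml
  have hlt : ∀ β' < β, s.hsum.coeff β' = 0 := by
    intro β' hβ'
    rw [hc β' hβ'.le, coeff_eq_zero_of_lt_order (by rwa [hmo]), mul_zero]
  have hβ := hc β le_rfl
  rw [hml] at hβ
  have hne : s.hsum.coeff β ≠ 0 := by
    rw [hβ]
    exact mul_ne_zero hg0.ne' (hm _ hgo).1.ne'
  have ho : s.hsum.order = β := by
    refine le_antisymm (order_le_of_coeff_ne_zero hne) ?_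
    by_contra! h'
    exact hr0 (coeff_order_eq_zero.1 (hlt _ h'))
  exact ⟨ho, by rw [leadingCoeff_eq (x := s.hsum), ho, hβ]⟩

end Leading

/-! ### Members of a flow have leading term `x` -/

section FlowLeading

open scoped Pointwise in
theorem good_support_of_X_mul {y : Transseries} (hy : Good (X * (1 + y)).support) :
    Good y.support := by
  have h1 : Good {-unitExp 0} := good_singleton (neg_mem (unitExp_mem_depth (Nat.zero_le 1)))
    ⟨0, by rw [exponent_neg_apply, unitExp_apply]; simp⟩
  have h2 : Good {(0 : Exponent)} := good_singleton (depth 1).zero_mem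
    ⟨0, by rw [exponent_zero_apply]; simp⟩
  refine ((hy.add h1).union h2).mono fun γ hγ => ?_
  by_cases h0 : γ = 0
  · exact Or.inr h0
  · refine Or.inl ⟨γ + unitExp 0, ?_, _, rfl, add_neg_cancel_right _ _⟩
    rw [mem_support, coeff_X_mul, add_sub_cancel_right, coeff_add, coeff_one, if_neg h0, zero_add]
    exact hγ

/-- A continuous additive function `ℝ → ℝ` is linear. -/
theorem additive_eq_mul {c : ℝ → ℝ} (hc : Continuous c) (hadd : ∀ s t, c (s + t) = c s + c t)
    (t : ℝ) : c t = t * c 1 := by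
  have h : c (t • (1 : ℝ)) = t • c 1 :=
    ((AddMonoidHom.mk' c hadd).toRealLinearMap hc).map_smul t 1
  simpa using h

/-- The members of a `C¹` flow whose time-one map has leading term `x` all have leading term `x`.
The orders of `F t` satisfy cocycle relations, and a well-ordered union of supports bounds them from
below, which forces them to be constant; the leading coefficients then form a continuous
one-parameter group, which is trivial. -/
theorem IsC1Flow.eq_X_mul {F : ℝ → Transseries} (hF : IsC1Flow F)
    (h1 : (F 1).leadingCoeff = 1) (t : ℝ) :
    ∃ y, 0 < y.orderTop ∧ Good y.support ∧ F t = X * (1 + y) := by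
  have hpos : ∀ t, 0 < (F t).leadingCoeff := fun t => (hF.add t 0).1
  have hne : ∀ t, F t ≠ 0 := fun t => leadingCoeff_ne_zero.1 (hpos t).ne'
  have hmem : ∀ t, (F t).order ∈ (F t).support := fun t => by
    rw [mem_support]
    exact fun h => hne t (coeff_order_eq_zero.1 h)
  have hgood : ∀ t, Good (F t).support := fun t => (mem_LHat_iff.1 (hF.mem t)).1
  have hdep : ∀ t, (F t).order ∈ depth 1 := fun t => (hgood t).depth _ (hmem t)
  have h0 : ∀ t, 0 < ofLex (F t).order 0 := fun t => (mem_LHat_iff.1 (hF.mem t)).2 _ (hmem t)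
  have hcomp := fun t s => order_of_isComp (hpos t) (hgood t).depth (hdep s) (h0 s) (hne (t + s))
    (hF.add s t)
  set α : ℝ → ℝ := fun t => ofLex (F t).order 0
  set m : ℝ → ℝ := fun t => ofLex (F t).order 1
  have hα : ∀ t s, α (t + s) = α t * α s := fun t s => by
    simp only [α]
    rw [(hcomp t s).1, compOrder_apply_zero]
  have hm : ∀ t s, m (t + s) = α t * m s + m t := fun t s => by
    simp only [α, m]
    rw [(hcomp t s).1, compOrder_apply_one]
  have hX : (F 0).order = unitExp 0 := by
    rw [hF.zero, X, order_single one_ne_zero]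
  have hα0 : α 0 = 1 := by
    simp only [α]
    rw [hX, unitExp_apply, if_pos rfl]
  have hm0 : m 0 = 0 := by
    simp only [m]
    rw [hX, unitExp_apply, if_neg (by omega)]
  obtain ⟨t₀, ht₀⟩ : ∃ t₀, ∀ t, (F t₀).order ≤ (F t).order := by
    have hwf : (Set.range fun t => (F t).order).IsWF := hF.wellOrdered.mono (by
      rintro _ ⟨t, rfl⟩
      exact Set.mem_iUnion.2 ⟨t, hmem t⟩)
    obtain ⟨t₀, ht₀⟩ := hwf.min_mem (Set.range_nonempty _)
    exact ⟨t₀, fun t => (ht₀.trans_le (hwf.min_le (Set.range_nonempty _) ⟨t, rfl⟩))⟩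
  have hα1 : ∀ t, α t = 1 := by
    have hge : ∀ t, 1 ≤ α t := fun t => by
      have h2 : α t₀ ≤ α (t₀ + t) := apply_zero_le_of_le (ht₀ _)
      rw [hα] at h2
      exact le_of_mul_le_mul_left (by rwa [mul_one]) (h0 t₀)
    intro t
    have h3 := hα t (-t)
    rw [add_neg_cancel, hα0] at h3
    nlinarith [hge t, hge (-t)]
  have hm1 : ∀ t, m t = 0 := by
    have hge : ∀ t, 0 ≤ m t := fun t => by
      have h2 : m t₀ ≤ m (t₀ + t) :=
        apply_one_le_of_le (ht₀ _) ((hα1 _).trans (hα1 _).symm)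
      rw [hm, hα1] at h2
      linarith
    intro t
    have h3 := hm t (-t)
    rw [add_neg_cancel, hm0, hα1] at h3
    linarith [hge t, hge (-t)]
  have hord : ∀ t, (F t).order = unitExp 0 := by
    refine fun t => exponent_ext fun j => ?_
    rcases j with _ | _ | j
    · exact (hα1 t).trans (by rw [unitExp_apply, if_pos rfl])
    · exact (hm1 t).trans (by rw [unitExp_apply, if_neg (by omega)])
    · rw [hdep t _ (by omega), unitExp_apply, if_neg (by omega)]
  have hmul : ∀ t s, (F (t + s)).leadingCoeff = (F t).leadingCoeff * (F s).leadingCoeff := by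
    intro t s
    have h2 : ofLex (unitExp 0) 0 = 1 := by rw [unitExp_apply, if_pos rfl]
    have h3 : ofLex (unitExp 0) 1 = 0 := by rw [unitExp_apply, if_neg (by omega)]
    rw [(hcomp t s).2, hord t, h2, h3, Real.rpow_one, Real.rpow_zero, mul_one]
  have hlc : ∀ t, (F t).leadingCoeff = (F t).coeff (unitExp 0) := fun t => by
    rw [leadingCoeff_eq, hord]
  have hcont : Continuous fun t => (F t).leadingCoeff := by
    simp only [hlc]
    exact (hF.contDiff (unitExp 0) (Set.mem_iUnion.2 ⟨0, hX ▸ hmem 0⟩)).continuous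
  have hone : (F t).leadingCoeff = 1 := by
    have h2 := additive_eq_mul (hcont.log fun t => (hpos t).ne') (fun s t => by
      rw [hmul, Real.log_mul (hpos s).ne' (hpos t).ne']) t
    rw [h1, Real.log_one, mul_zero] at h2
    exact Real.eq_one_of_pos_of_log_eq_zero (hpos t) h2
  have heq := eq_single_mul_remainder (hne t)
  rw [hord, hone] at heq
  exact ⟨_, orderTop_remainder_pos (hne t), good_support_of_X_mul (heq ▸ hgood t), heq⟩

end FlowLeading

/-! ### Uniqueness of the Fatou coordinate and of the flow -/

section Uniqueness

variable {z : Transseries} {N : ℕ}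

theorem const_support_subset (c : ℝ) : (const c).support ⊆ depth N :=
  support_single_subset_of_mem (L := (depth N).toAddSubmonoid) (depth N).zero_mem _

theorem lin_mon_const (z : Transseries) (c : ℝ) : lin (mon z) (const c) = const c := by
  rw [const, C_apply, lin_single, mon_zero]
  ext γ
  simp [coeff_single, coeff_one]

theorem exists_support_subset_depth {Ψ : Transseries} (h : Ψ ∈ LAll) :
    ∃ N, Ψ.support ⊆ depth N := by
  obtain ⟨N, hN⟩ := Set.mem_iUnion.1 h
  exact ⟨N, (mem_LInf_iff.1 hN).1⟩

theorem isFatou_iff (hz : 0 < z.orderTop) {Ψ : Transseries} :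
    IsFatou (X * (1 + z)) Ψ ↔ Ψ ∈ LAll ∧ lin (mon z) Ψ = Ψ + 1 := by
  refine and_congr_right fun h => ?_
  obtain ⟨N, hN⟩ := exists_support_subset_depth h
  simp only [isComp_iff hz hN, exists_eq_left, sub_eq_iff_eq_add']

theorem add_const_mem_LInf {Ψ : Transseries} {j : ℕ} (h : Ψ ∈ LInf j) (c : ℝ) :
    Ψ + const c ∈ LInf j := by
  rw [mem_LInf_iff] at *
  refine ⟨support_add_subset_of_mem (L := (depth j).toAddSubmonoid) h.1 (const_support_subset c),
    (h.2.insert 0).mono fun γ hγ => ?_⟩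
  rcases support_add_subset _ _ hγ with h' | h'
  · exact Or.inr h'
  · exact Or.inl (eq_of_mem_support_single h')

theorem lin_mon_add_const (hz : 0 < z.orderTop) {Ψ : Transseries} (hΨ : Ψ.support ⊆ depth N)
    (c : ℝ) : lin (mon z) (Ψ + const c) = lin (mon z) Ψ + const c := by
  rw [lin_add (shiftBounded_mon hz N) hΨ (const_support_subset c), lin_mon_const]

theorem eq_add_const_of_lin_mon (hz : 0 < z.orderTop) (hz0 : z ≠ 0) {Ψ Φ : Transseries}
    (hΨN : Ψ.support ⊆ depth N) (hΦN : Φ.support ⊆ depth N) (hΨ : lin (mon z) Ψ = Ψ + 1)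
    (hΦ : lin (mon z) Φ = Φ + 1) : ∃ c : ℝ, Φ = Ψ + const c := by
  have hg : (Φ - Ψ).support ⊆ depth N :=
    support_sub_subset_of_mem (L := (depth N).toAddSubmonoid) hΦN hΨN
  obtain ⟨c, hc⟩ := eq_const_of_isComp_self hz hz0 ((isComp_iff hz hg).2 (by
    rw [lin_sub (shiftBounded_mon hz N) hΦN hΨN, hΨ, hΦ, add_sub_add_right_eq_sub]))
  exact ⟨c, sub_eq_iff_eq_add'.1 hc⟩

theorem star_zero_left (hzN : z.support ⊆ depth N) : star 0 z = z := by
  apply X_mul_injective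
  rw [← X_mul_star (by simp) hzN, lin_mon_zero]

theorem star_zero_right (z : Transseries) : star z 0 = z := by
  simp [star, lin_zero]

theorem star_assoc {u v w : Transseries} (hu : 0 < u.orderTop) (hv : 0 < v.orderTop)
    (hvN : v.support ⊆ depth N) (hwN : w.support ⊆ depth N) :
    star u (star v w) = star (star u v) w := by
  apply X_mul_injective
  rw [← X_mul_star hu (support_star hv hvN hwN), ← X_mul_star hv hwN,
    lin_mon_lin_mon hu hv hvN (X_mul_support hwN), X_mul_star (star_pos hu hv hvN) hwN]

/-- The `C¹` flow of `x (1 + z)` is unique. A member `F t` of a flow commutes with `x (1 + z)`,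
hence it changes a Fatou coordinate by a constant `c t`, hence it is the member at time `c t` of the
polynomial flow `x (1 + Z)`. The function `c` is additive and continuous with `c 1 = 1`. -/
theorem IsC1Flow.eq_polynomial_flow (hz : 0 < z.orderTop) (hz0 : z ≠ 0) (hzg : Good z.support)
    {Z : HahnSeries Exponent (Polynomial ℝ)} (hZ : 0 < Z.orderTop)
    (hZS : Z.support ⊆ genSubmonoid z 1)
    (hev : ∀ n : ℕ, mapHom (Polynomial.evalRingHom (n : ℝ)) Z = iterRem z n)
    {F : ℝ → Transseries} (hF : IsC1Flow F) (hF1 : F 1 = X * (1 + z)) (t : ℝ) :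
    F t = X * (1 + mapHom (Polynomial.evalRingHom t) Z) := by
  have hX := order_single_mul_one_add (γ := unitExp 0) one_ne_zero hz
  choose y hy0 hyg hy using hF.eq_X_mul (by rw [hF1]; exact hX.2)
  have hy1 : y 1 = z := X_mul_injective ((hy 1).symm.trans hF1)
  have hyN : ∀ t, (y t).support ⊆ depth 2 := fun t =>
    fun γ h => depth_mono (by norm_num) ((hyg t).depth γ h)
  have hzN1 : z.support ⊆ depth 1 := hzg.depth
  have hzN : z.support ⊆ depth 2 := hy1 ▸ hyN 1
  have hstar : ∀ s t, star (y s) (y t) = y (t + s) := fun s t => by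
    have h := hF.add s t
    rw [hy s, isComp_iff (hy0 s) (hy t ▸ X_mul_support (hyN t)), hy, hy t,
      X_mul_star (hy0 s) (hyN t)] at h
    exact (X_mul_injective h).symm
  set ζ : ℝ → Transseries := fun t => mapHom (Polynomial.evalRingHom t) Z
  have hZN1 : Z.support ⊆ depth 1 := hZS.trans (genSubmonoid_le_depth hzN1)
  have hZN : Z.support ⊆ depth 2 := hZN1.trans (depth_mono (by norm_num))
  have hζ0 : ∀ t, 0 < (ζ t).orderTop := fun t => orderTop_mapHom_pos _ hZ
  have hζN : ∀ t, (ζ t).support ⊆ depth 2 := fun t => (support_mapHom _ _).trans hZN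
  have hζstar : ∀ s t, star (ζ s) (ζ t) = ζ (s + t) := star_eval hz hzN hZ hZN hev
  obtain ⟨Ψ, -, hΨN, hΨ⟩ := exists_lin_mon_eq_add_one hz hz0 hzg
  have hc : ∀ t, ∃ c : ℝ, lin (mon (y t)) Ψ = Ψ + const c := fun t => by
    refine eq_add_const_of_lin_mon hz hz0 hΨN (support_lin_mon (hy0 t) (hyN t) hΨN) hΨ ?_
    have h1 : star z (y t) = star (y t) z := by
      rw [← hy1, hstar, hstar, add_comm]
    rw [lin_mon_lin_mon hz (hy0 t) (hyN t) hΨN, h1, ← lin_mon_lin_mon (hy0 t) hz hzN hΨN, hΨ]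
    simpa [const] using lin_mon_add_const (hy0 t) hΨN 1
  choose c hc using hc
  -- The composition of `F t` with the polynomial flow at time `-c t` fixes `Ψ`; as `Ψ` is not
  -- constant, it is the identity.
  have hid : ∀ t, star (ζ (-c t)) (y t) = 0 := fun t => by
    by_contra hne
    have hpos := star_pos (hζ0 (-c t)) (hy0 t) (hyN t)
    obtain ⟨a, ha⟩ := eq_const_of_isComp_self hpos hne ((isComp_iff hpos hΨN).2 (by
      rw [← lin_mon_lin_mon (hζ0 _) (hy0 t) (hyN t) hΨN, hc, lin_mon_add_const (hζ0 _) hΨN,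
        lin_mon_eval_of_add_one hz hzN hZ hev hΨN hΨ, add_assoc, const, const, ← map_add,
        neg_add_cancel, map_zero, add_zero]))
    rw [ha, lin_mon_const] at hΨ
    exact one_ne_zero (left_eq_add.1 hΨ)
  have hyζ : ∀ t, y t = ζ (c t) := fun t => by
    have h := star_assoc (hζ0 (c t)) (hζ0 (-c t)) (hζN (-c t)) (hyN t)
    have h0 : ζ 0 = 0 := by
      have := hev 0
      rw [Nat.cast_zero] at this
      exact this
    rw [hid, star_zero_right, hζstar, add_neg_cancel, h0, star_zero_left (hyN t)] at h
    exact h.symm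
  have hcoef : ∀ t, (ζ t).coeff z.order = z.leadingCoeff * t :=
    coeff_eval_order hz hz0 hzN hev
  have hl : z.leadingCoeff ≠ 0 := leadingCoeff_ne_zero.2 hz0
  have hcF : ∀ t, c t = z.leadingCoeff⁻¹ * (F t).coeff (unitExp 0 + z.order) := fun t => by
    rw [hy, coeff_X_mul, add_sub_cancel_left, coeff_add, coeff_one,
      if_neg ((zero_lt_orderTop_iff hz0).1 hz).ne', zero_add, hyζ, hcoef, inv_mul_cancel_left₀ hl]
  have hc1 : c 1 = 1 := by
    have h := hcoef (c 1)
    rw [← hyζ, hy1, ← leadingCoeff_eq] at h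
    exact (mul_eq_left₀ hl).1 h.symm
  have hcont : Continuous c := by
    have hmem : unitExp 0 + z.order ∈ ⋃ t, (F t).support := by
      refine Set.mem_iUnion.2 ⟨1, fun h => ?_⟩
      have := hcF 1
      rw [h, mul_zero, hc1] at this
      exact one_ne_zero this
    rw [funext hcF]
    exact continuous_const.mul (hF.contDiff _ hmem).continuous
  have hadd : ∀ s t, c (s + t) = c s + c t := fun s t => by
    have h := hcoef (c (s + t))
    rw [← hyζ, add_comm s t, ← hstar, hyζ, hyζ, hζstar, hcoef] at h
    rw [add_comm s t]
    exact (mul_left_cancel₀ hl h).symm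
  have hct := additive_eq_mul hcont hadd t
  rw [hc1, mul_one] at hct
  rw [hy, hyζ, hct]

end Uniqueness

end LogTransseries

theorem mainTheorem2 (f : LogTransseries.Transseries)
    (hf : LogTransseries.IsParabolic f) (hne : f ≠ LogTransseries.X) :
    (∃ Ψ, LogTransseries.IsFatou f Ψ) ∧
    (∀ Ψ Φ, LogTransseries.IsFatou f Ψ →
      (LogTransseries.IsFatou f Φ ↔ ∃ c : ℝ, Φ = Ψ + LogTransseries.const c)) ∧
    (∀ Ψ, LogTransseries.IsFatou f Ψ → Ψ ∈ LogTransseries.LInf 2) ∧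
    (∃! F : ℝ → LogTransseries.Transseries, LogTransseries.EmbedsInC1Flow f F) ∧
    (∀ F : ℝ → LogTransseries.Transseries, LogTransseries.EmbedsInC1Flow f F →
      ∀ Ψ, LogTransseries.IsFatou f Ψ → ∀ t : ℝ, ∃ r,
        LogTransseries.IsComp Ψ (F t) r ∧ r - Ψ = LogTransseries.const t) := by
  open LogTransseries in
  obtain ⟨hfL, hfo, hfl⟩ := hf
  have hf0 : f ≠ 0 := HahnSeries.leadingCoeff_ne_zero.1 (by rw [hfl]; exact one_ne_zero)
  obtain ⟨z, hz, rfl⟩ : ∃ z, 0 < z.orderTop ∧ f = X * (1 + z) := by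
    have h := eq_single_mul_remainder hf0
    rw [hfo, hfl] at h
    exact ⟨_, orderTop_remainder_pos hf0, h⟩
  have hz0 : z ≠ 0 := by
    rintro rfl
    exact hne (by rw [add_zero, mul_one])
  have hzg : Good z.support := good_support_of_X_mul (mem_LHat_iff.1 hfL).1
  have hzN : z.support ⊆ depth 1 := hzg.depth
  obtain ⟨Ψ₀, ⟨G, hG, hΨG⟩, hΨN, hΨ⟩ := exists_lin_mon_eq_add_one hz hz0 hzg
  have hΨL : Ψ₀ ∈ LInf 2 := mem_LInf_iff.2 ⟨hΨN, (hG.lowerFinite.insert _).mono hΨG⟩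
  have hΨF : IsFatou (X * (1 + z)) Ψ₀ := (isFatou_iff hz).2 ⟨Set.mem_iUnion.2 ⟨2, hΨL⟩, hΨ⟩
  have huniq : ∀ Ψ Φ, IsFatou (X * (1 + z)) Ψ → IsFatou (X * (1 + z)) Φ →
      ∃ c : ℝ, Φ = Ψ + const c := by
    intro Ψ Φ h h'
    rw [isFatou_iff hz] at h h'
    obtain ⟨N, hN⟩ := exists_support_subset_depth h.1
    obtain ⟨N', hN'⟩ := exists_support_subset_depth h'.1
    exact eq_add_const_of_lin_mon hz hz0 (hN.trans (depth_mono (le_max_left N N')))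
      (hN'.trans (depth_mono (le_max_right N N'))) h.2 h'.2
  have hdepth : ∀ Ψ, IsFatou (X * (1 + z)) Ψ → Ψ ∈ LInf 2 := by
    intro Ψ h
    obtain ⟨c, rfl⟩ := huniq _ _ hΨF h
    exact add_const_mem_LInf hΨL c
  obtain ⟨Z, hZ, hZS, hev⟩ := exists_polynomial_flow hz hz0 hzN
  have hflow : ∀ F : ℝ → Transseries, EmbedsInC1Flow (X * (1 + z)) F →
      F = fun t => X * (1 + mapHom (Polynomial.evalRingHom t) Z) := fun F hF =>
    funext (hF.1.eq_polynomial_flow hz hz0 hzg hZ hZS hev hF.2)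
  refine ⟨⟨Ψ₀, hΨF⟩, fun Ψ Φ h => ⟨huniq Ψ Φ h, ?_⟩, hdepth,
    ⟨_, ⟨isC1Flow_eval hz hzg hZ hZS hev, ?_⟩, hflow⟩, ?_⟩
  · rintro ⟨c, rfl⟩
    have hL := hdepth Ψ h
    refine (isFatou_iff hz).2 ⟨Set.mem_iUnion.2 ⟨2, add_const_mem_LInf hL c⟩, ?_⟩
    rw [lin_mon_add_const hz (mem_LInf_iff.1 hL).1, ((isFatou_iff hz).1 h).2, add_right_comm]
  · have h := hev 1
    rw [Nat.cast_one, iterRem_one] at h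
    simp only [h]
  · intro F hF Ψ h t
    have hN := (mem_LInf_iff.1 (hdepth Ψ h)).1
    rw [hflow F hF]
    refine ⟨_, (isComp_iff (orderTop_mapHom_pos _ hZ) hN).2 rfl, ?_⟩
    rw [lin_mon_eval_of_add_one hz (hzN.trans (depth_mono (by norm_num))) hZ hev hN
      ((isFatou_iff hz).1 h).2, add_sub_cancel_left]
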